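/- Let $M$ be a compact metric space and let $X=\{X^t\}_{t\in\mathbb R}$ be a (jointly continuous) flow on $M$ without fixed points. For $I\subset\mathbb R$ and $A\subset M$ write $X^I(A)=\{X^t(x): t\in I, x\in A\}$. A continuum is a non-empty compact connected set. *cw-expansiveness.* For $A\subset M$, $\mathcal H(A)$ is the set of maps $\alpha$ from $A$ to the homeomorphisms of $\mathbb R$ fixing $0$, such that $x\mapsto\alpha(x)(t)$ is continuous on $A$ for each $t$, and $\alpha(x_\alpha)=\mathrm{id}_{\mathbb R}$ for some $x_\alpha\in A$. Put $\mathcal X_\alpha^t(A)=\{X^{\alpha(x)(t)}(x): x\in A\}$. The flow is *cw-expansive* if for every $e>0$ there is $d>0$ such that, for every continuum $A\subset M$ and every $\alpha\in\mathcal H(A)$ with $\operatorname{diam}\mathcal X^t_\alpha(A)<d$ for all $t\in\mathbb R$, one has $A\subset X^{(-e,e)}(x_\alpha)$. *Adequate pairs.* A closed set $S\subset M$ is a cross-section of time $\epsilon>0$ if $S\cap X^{(-\epsilon,\epsilon)}(x)=\{x\}$ for all $x\in S$; put $S^*=\operatorname{int}(X^{(-\epsilon,\epsilon)}(S))\cap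 S$. Let $\delta>0$. A pair $(\mathcal S,\mathcal T)$ of finite families $\mathcal S=\{S_1,\dots,S_k\}$, $\mathcal T=\{T_1,\dots,T_k\}$ is *$\delta$-adequate* (with time $\epsilon>0$) if all $S_i,T_i$ are cross-sections of time $\epsilon$ of diameter at most $\delta$, $T_i\subset S_i^*$ for each $i$, and $$M=\bigcup_i X^{[0,\epsilon]}(T_i)=\bigcup_i X^{[-\epsilon,0]}(T_i)=\bigcup_i X^{[0,\epsilon]}(S_i)=\bigcup_i X^{[-\epsilon,0]}(S_i).$$ Let $\theta=\sup\{d>0:\ X^{(0,d)}(x)\cap\bigcup_iS_i=\emptyset\ \text{for all } x\in\bigcup_i S_i\}$ (with $\theta=0$ if there is no such $d$). Constants $\rho,\epsilon_0>0$ are *admissible* for the pair if $5\rho<\epsilon$, $2\rho<\theta$, $\epsilon_0<\theta/2$, and, with $D^j_\rho=X^{(-\rho,\rho)}(S_j)$: whenever $x,y\in S_i$, $d(x,y)<\epsilon_0$, $|t|<3\delta$ and $X^t(x)\in T_j$, then $X^t(y)\in D^j_\rho$. Let $P^j_\rho:D^j_\rho\to S_j$ be the projection $y\mapsto X^t(y)\in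 S_j$, $|t|<\rho$. Let $\phi:\bigcup_iT_i\to\bigcup_iT_i$ be the first return map. *Local stable and unstable sets.* For a continuum $A\subset S_j$ and $x\in A\cap T_j$ put $\phi^0(A,x)=A$ and, recursively for $n\ge0$, $\phi^{n+1}(A,x)=P^l_\rho(X^t(\phi^n(A,x)))$, where $t>0$ is the first return time of $\phi^n(x)$ and $\phi^{n+1}(x)\in T_l$; this is defined if $X^t(\phi^n(A,x))\subset D^l_\rho$. Define $\phi^n(A,x)$ for $n<0$ in the same way, using the reversed flow. For $0<\eta<\epsilon_0$ let $W^s_\eta(\mathcal S,\mathcal T)$ (respectively $W^u_\eta(\mathcal S,\mathcal T)$) be the set of continua $A$ contained in some $S_j$ for which there is $x\in A\cap T_j$ such that $\phi^n(A,x)$ is defined and $\operatorname{diam}\phi^n(A,x)<\eta$ for all $n\ge0$ (respectively for all $n\le0$). **Theorem.** Let $\delta>0$. The flow $X$ is cw-expansive if and only if, for every $\delta$-adequate pair $(\mathcal S,\mathcal T)$ (with any time $\epsilon>0$) and all admissible $\rho,\epsilon_0$, there is $\eta\in(0,\epsilon_0)$ such that $$W^s_\eta(\mathcal S,\mathcal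 T)\cap W^u_\eta(\mathcal S,\mathcal T)=\Big\{\{x\}:\ x\in\bigcup_{i=1}^kT_i\Big\}.$$ -/

import Mathlib

open Set

noncomputable section

namespace CwFlow

variable {M : Type*} [MetricSpace M]

/-- `X^I(A) = {X^t(x) : t ∈ I, x ∈ A}`. -/
def flowImage (X : Flow ℝ M) (I : Set ℝ) (A : Set M) : Set M :=
  {y | ∃ t ∈ I, ∃ x ∈ A, X t x = y}

/-- An element `α` of `H(A)`: a family of homeomorphisms of `ℝ` fixing `0`, indexed by `A`,
pointwise continuous on `A`, together with its guide point `x_α`, where the homeomorphism is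
the identity. -/
structure Reparam (A : Set M) where
  toHomeo : A → (ℝ ≃ₜ ℝ)
  map_zero : ∀ x, toHomeo x 0 = 0
  continuous_apply : ∀ t : ℝ, Continuous fun x : A => toHomeo x t
  guide : A
  guide_eq : ∀ t : ℝ, toHomeo guide t = t

/-- `X_α^t(A) = {X^{α(x)(t)}(x) : x ∈ A}`. -/
def Reparam.image (X : Flow ℝ M) {A : Set M} (α : Reparam A) (t : ℝ) : Set M :=
  Set.range fun x : A => X (α.toHomeo x t) (x : M)

/-- Continuum-wise expansiveness of a flow. -/
def IsCwExpansive (X : Flow ℝ M) : Prop :=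
  ∀ ε : ℝ, 0 < ε → ∃ δ : ℝ, 0 < δ ∧
    ∀ A : Set M, IsCompact A → IsConnected A → ∀ α : Reparam A,
      (∀ t : ℝ, Metric.diam (α.image X t) < δ) →
        A ⊆ flowImage X (Ioo (-ε) ε) {(α.guide : M)}

/-- `S` is a cross-section of time `ε`. -/
structure IsCrossSection (X : Flow ℝ M) (ε : ℝ) (S : Set M) : Prop where
  isClosed : IsClosed S
  inter_eq : ∀ x ∈ S, S ∩ flowImage X (Ioo (-ε) ε) {x} = {x}

/-- The interior `S^*` of a cross-section of time `ε`. -/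
def sectionInterior (X : Flow ℝ M) (ε : ℝ) (S : Set M) : Set M :=
  interior (flowImage X (Ioo (-ε) ε) S) ∩ S

/-- `(S, T)` is a `δ`-adequate pair of finite families of cross-sections of time `ε`. -/
structure IsAdequatePair (X : Flow ℝ M) (ε δ : ℝ) {k : ℕ} (S T : Fin k → Set M) : Prop where
  time_pos : 0 < ε
  crossS : ∀ i, IsCrossSection X ε (S i)
  crossT : ∀ i, IsCrossSection X ε (T i)
  diamS : ∀ i, Metric.diam (S i) ≤ δ
  diamT : ∀ i, Metric.diam (T i) ≤ δ
  subset : ∀ i, T i ⊆ sectionInterior X ε (S i)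
  coverT : ⋃ i, flowImage X (Icc 0 ε) (T i) = univ
  coverT' : ⋃ i, flowImage X (Icc (-ε) 0) (T i) = univ
  coverS : ⋃ i, flowImage X (Icc 0 ε) (S i) = univ
  coverS' : ⋃ i, flowImage X (Icc (-ε) 0) (S i) = univ

/-- `θ`: the supremum of all `d > 0` such that no point of `⋃ S_i` meets `⋃ S_i` again at a time
in `(0, d)`. If there is no such `d`, its value is `0`. -/
def gap (X : Flow ℝ M) {k : ℕ} (S : Fin k → Set M) : ℝ :=
  sSup {d : ℝ | 0 < d ∧ ∀ x ∈ ⋃ i, S i, flowImage X (Ioo 0 d) {x} ∩ (⋃ i, S i) = ∅}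

/-- The flow box `D_ρ = X^{(-ρ,ρ)}(S)`. -/
def flowBox (X : Flow ℝ M) (ρ : ℝ) (S : Set M) : Set M :=
  flowImage X (Ioo (-ρ) ρ) S

/-- The image `P_ρ(B)` of `B ⊆ D_ρ` under the projection `P_ρ : D_ρ → S` along the flow, which
sends `y` to the point `X^t(y)` of `S` with `|t| < ρ`. This point is unique when `S` is a
cross-section of time `ε > 2ρ`. -/
def projImage (X : Flow ℝ M) (ρ : ℝ) (S B : Set M) : Set M :=
  {z | z ∈ S ∧ ∃ y ∈ B, ∃ t : ℝ, |t| < ρ ∧ X t y = z}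

/-- The constants `ρ` and `ε₀` attached to a `δ`-adequate pair of time `ε`. -/
structure Admissible (X : Flow ℝ M) (ε δ : ℝ) {k : ℕ} (S T : Fin k → Set M) (ρ ε₀ : ℝ) :
    Prop where
  rho_pos : 0 < ρ
  rho_lt_time : 5 * ρ < ε
  rho_lt_gap : 2 * ρ < gap X S
  eps_pos : 0 < ε₀
  eps_lt : ε₀ < gap X S / 2
  mem_box : ∀ i, ∀ x ∈ S i, ∀ y ∈ S i, dist x y < ε₀ → ∀ t : ℝ, |t| < 3 * δ →
    ∀ j, X t x ∈ T j → X t y ∈ flowBox X ρ (S j)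

/-- The smallest `t > 0` with `X^t(x) ∈ ⋃ T_i`. -/
def returnTime (X : Flow ℝ M) {k : ℕ} (T : Fin k → Set M) (x : M) : ℝ :=
  sInf {t : ℝ | 0 < t ∧ X t x ∈ ⋃ i, T i}

/-- The first return map `φ` to `⋃ T_i`. -/
def firstReturn (X : Flow ℝ M) {k : ℕ} (T : Fin k → Set M) (x : M) : M :=
  X (returnTime X T x) x

/-- `φ(B, p)` is defined: with `t` the return time of `p` and `φ(p) ∈ T_l`, the set `X^t(B)` lies
in the flow box of `S_l`. -/
def StepDefined (X : Flow ℝ M) (ρ : ℝ) {k : ℕ} (S T : Fin k → Set M) (B : Set M) (p : M) : Prop :=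
  ∃ l, firstReturn X T p ∈ T l ∧ X (returnTime X T p) '' B ⊆ flowBox X ρ (S l)

/-- `φ(B, p) = P_ρ^l(X^t(B))`, with `t` the return time of `p` and `φ(p) ∈ T_l`. If the
`S_i` are not disjoint, the choice of `l` does not matter: two projections of one point lie on the
same orbit at time distance below `2ρ`, and `2ρ < gap X S`, so they agree. -/
def stepImage (X : Flow ℝ M) (ρ : ℝ) {k : ℕ} (S T : Fin k → Set M) (B : Set M) (p : M) : Set M :=
  {z | ∃ l, firstReturn X T p ∈ T l ∧ z ∈ projImage X ρ (S l) (X (returnTime X T p) '' B)}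

/-- `φ^n(A, x)` for `n ≥ 0`, following the orbit `x, φ(x), φ²(x), …`. -/
def iterNat (X : Flow ℝ M) (ρ : ℝ) {k : ℕ} (S T : Fin k → Set M) (A : Set M) (x : M) :
    ℕ → Set M
  | 0 => A
  | n + 1 => stepImage X ρ S T (iterNat X ρ S T A x n) ((firstReturn X T)^[n] x)

/-- `φ^n(A, x)` is defined, for `n ≥ 0`. -/
def IterNatDefined (X : Flow ℝ M) (ρ : ℝ) {k : ℕ} (S T : Fin k → Set M) (A : Set M) (x : M)
    (n : ℕ) : Prop :=
  ∀ m < n, StepDefined X ρ S T (iterNat X ρ S T A x m) ((firstReturn X T)^[m] x)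

/-- `φ^n(A, x)` for `n : ℤ`. Negative iterates are the positive ones for the reversed flow
`t ↦ X^{-t}`, whose first return map to `⋃ T_i` is `φ⁻¹`. -/
def iterSet (X : Flow ℝ M) (ρ : ℝ) {k : ℕ} (S T : Fin k → Set M) (A : Set M) (x : M) :
    ℤ → Set M
  | Int.ofNat n => iterNat X ρ S T A x n
  | Int.negSucc n => iterNat X.reverse ρ S T A x (n + 1)

/-- `φ^n(A, x)` is defined, for `n : ℤ`. -/
def IterDefined (X : Flow ℝ M) (ρ : ℝ) {k : ℕ} (S T : Fin k → Set M) (A : Set M) (x : M) :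
    ℤ → Prop
  | Int.ofNat n => IterNatDefined X ρ S T A x n
  | Int.negSucc n => IterNatDefined X.reverse ρ S T A x (n + 1)

/-- The local stable set `W^s_η(S, T)`. -/
def stableSet (X : Flow ℝ M) (ρ : ℝ) {k : ℕ} (S T : Fin k → Set M) (η : ℝ) : Set (Set M) :=
  {A | IsCompact A ∧ IsConnected A ∧ ∃ j, A ⊆ S j ∧ ∃ x ∈ A ∩ T j, ∀ n : ℤ, 0 ≤ n →
    IterDefined X ρ S T A x n ∧ Metric.diam (iterSet X ρ S T A x n) < η}

/-- The local unstable set `W^u_η(S, T)`. -/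
def unstableSet (X : Flow ℝ M) (ρ : ℝ) {k : ℕ} (S T : Fin k → Set M) (η : ℝ) : Set (Set M) :=
  {A | IsCompact A ∧ IsConnected A ∧ ∃ j, A ⊆ S j ∧ ∃ x ∈ A ∩ T j, ∀ n : ℤ, n ≤ 0 →
    IterDefined X ρ S T A x n ∧ Metric.diam (iterSet X ρ S T A x n) < η}

end CwFlow

end

/-! Both conditions say that a continuum which stays small for all time, up to a change of time on
each orbit, lies in one short orbit arc. Cross-sections replace the changes of time by visit times.
The basic tool is separation: a short orbit arc meets the union of the sections at most once, so
short hitting times are unique, hence continuous and uniformly controlled.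

Suppose X is cw-expansive and all iterates of A are small. Each point y of A meets the iterates at
times that are continuous in y and have increments nearly independent of y (`exists_visit_times`).
Linear interpolation of these times gives a reparametrization keeping A small (`exists_reparam`).
Expansiveness then puts A in an orbit arc shorter than the gap, and this arc meets the section only
once.

For the converse a single adequate pair is enough. Without fixed points there are no short periods,
so an orbit shadowing another one cannot drift in time (`exists_drift`). If α keeps A small,
projecting the image of A to a section at a visit of the guide gives a continuum all of whose
iterates are defined and small (`exists_shadow_iterates`); it is therefore a point, and A lies in an
orbit arc. The pair itself is built in `exists_adequatePair`: local sections are level sets of a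
function increasing along the flow, and small pieces of them are made disjoint by shifting them in
time. -/

open Filter Topology

namespace CwFlow

variable {M : Type*} [MetricSpace M]

/-! ### Closed sets separated along orbits -/

/-- Uniform continuity of a flow on bounded time intervals. -/
theorem uniform_flow [CompactSpace M] (X : Flow ℝ M) (L : ℝ) {r : ℝ} (hr : 0 < r) :
    ∃ d > 0, ∀ s t : ℝ, |s| ≤ L → |t| ≤ L → |s - t| < d → ∀ x y : M, dist x y < d →
      dist (X s x) (X t y) < r := by
  have hc : IsCompact (Icc (-L) L ×ˢ (univ : Set M)) := isCompact_Icc.prod isCompact_univ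
  have hu := hc.uniformContinuousOn_of_continuous (f := fun p : ℝ × M => X p.1 p.2)
    (by fun_prop)
  obtain ⟨d, hd, h⟩ := Metric.uniformContinuousOn_iff.1 hu r hr
  refine ⟨d, hd, fun s t hs ht hst x y hxy => ?_⟩
  refine h (s, x) ⟨abs_le.1 hs, mem_univ _⟩ (t, y) ⟨abs_le.1 ht, mem_univ _⟩ ?_
  rw [Prod.dist_eq, max_lt_iff]
  exact ⟨by simpa [Real.dist_eq] using hst, hxy⟩

/-- Orbit arcs shorter than `g` meet `K` at most once. -/
def Separated (X : Flow ℝ M) (K : Set M) (g : ℝ) : Prop :=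
  ∀ x ∈ K, ∀ t : ℝ, |t| < g → X t x ∈ K → t = 0

theorem Separated.eq {X : Flow ℝ M} {K : Set M} {g : ℝ} (h : Separated X K g) {x : M} {s t : ℝ}
    (hs : X s x ∈ K) (ht : X t x ∈ K) (hst : |s - t| < g) : s = t := by
  have := h _ ht (s - t) hst (by rw [← Flow.map_add]; simpa using hs)
  linarith

theorem Separated.reverse {X : Flow ℝ M} {K : Set M} {g : ℝ} (h : Separated X K g) :
    Separated X.reverse K g := fun x hx t ht hxt => by
  have := h x hx (-t) (by rwa [abs_neg]) hxt
  linarith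

/-- Time translations of bounded size into a separated closed set are continuous. -/
theorem Separated.continuous {X : Flow ℝ M} {K : Set M} {g ρ : ℝ} (h : Separated X K g)
    (hK : IsClosed K) (hρ : 2 * ρ < g) {A : Type*} [TopologicalSpace A] {f : A → M}
    (hf : Continuous f) {s : A → ℝ} (hs : ∀ a, |s a| ≤ ρ) (hsK : ∀ a, X (s a) (f a) ∈ K) :
    Continuous s := by
  rw [continuous_iff_continuousAt]
  intro a
  rw [ContinuousAt, Metric.tendsto_nhds]
  intro η hη
  -- At a time u of this compact set the orbit of `f a` misses K, since u and `s a` differ by at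
  -- most 2ρ < g. Missing K is an open condition, so compactness gives one neighbourhood of a for
  -- all these u.
  have hC : IsCompact (Icc (-ρ) ρ ∩ {u | η ≤ dist u (s a)}) :=
    isCompact_Icc.inter_right (isClosed_le (by fun_prop) (by fun_prop))
  have := hC.eventually_forall_of_forall_eventually (x₀ := a) (P := fun b u => X u (f b) ∉ K) ?_
  · filter_upwards [this] with b hb
    by_contra hlt
    exact hb (s b) ⟨abs_le.1 (hs b), not_lt.1 hlt⟩ (hsK b)
  · rintro u ⟨hu, hu'⟩
    have hcont : Continuous fun z : A × ℝ => X z.2 (f z.1) := by fun_prop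
    refine (hK.isOpen_compl.preimage hcont).mem_nhds ?_
    intro hmem
    have h1 : u = s a := h.eq hmem (hsK a) (by
      have h2 := abs_le.2 hu
      have h3 := hs a
      have := abs_sub u (s a)
      linarith)
    rw [h1] at hu'
    simp only [mem_ofPred_eq, dist_self] at hu'
    linarith

/-- Nearby points reach a separated compact set at nearby times. -/
theorem Separated.uniform [CompactSpace M] {X : Flow ℝ M} {K : Set M} {g ρ : ℝ}
    (h : Separated X K g) (hK : IsClosed K) (hρ : ρ < g) (L : ℝ) {κ : ℝ} (hκ : 0 < κ) :
    ∃ η > 0, ∀ p z : M, dist p z < η → ∀ t s : ℝ, |t| ≤ L → |s| ≤ ρ → X t p ∈ K →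
      X (t + s) z ∈ K → |s| < κ := by
  rcases K.eq_empty_or_nonempty with rfl | hne
  · exact ⟨1, one_pos, fun p z _ t s _ _ h' => absurd h' (notMem_empty _)⟩
  -- The configurations (p, t, s) violating the conclusion with z = p, except that `X (t + s) p` is
  -- then off K by separation. Its distance to K has a positive minimum, which z close to p cannot
  -- bridge.
  have hC : IsCompact {q : M × ℝ × ℝ | q.2.1 ∈ Icc (-L) L ∧ q.2.2 ∈ Icc (-ρ) ρ ∧ κ ≤ |q.2.2| ∧
      X q.2.1 q.1 ∈ K} := by
    refine (isCompact_univ.prod (isCompact_Icc.prod isCompact_Icc) :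
      IsCompact ((univ : Set M) ×ˢ (Icc (-L) L ×ˢ Icc (-ρ) ρ))).of_isClosed_subset ?_ ?_
    · refine IsClosed.and ?_ (IsClosed.and ?_ (IsClosed.and ?_ ?_))
      · exact isClosed_Icc.preimage (by fun_prop)
      · exact isClosed_Icc.preimage (by fun_prop)
      · exact isClosed_le (by fun_prop) (by fun_prop)
      · exact hK.preimage (by fun_prop)
    · rintro q ⟨h1, h2, -⟩
      exact ⟨mem_univ _, h1, h2⟩
  obtain ⟨m, hm, hmin⟩ := hC.exists_forall_le' (a := 0)
    (f := fun q : M × ℝ × ℝ => Metric.infDist (X (q.2.1 + q.2.2) q.1) K)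
    ((Metric.continuous_infDist_pt K).comp (by fun_prop)).continuousOn (by
      rintro ⟨p, t, s⟩ ⟨-, h2, h3, h4⟩
      refine (hK.notMem_iff_infDist_pos hne).1 fun hmem => ?_
      have : t + s = t := h.eq hmem h4 (by
        have := abs_le.2 h2
        simp only [add_sub_cancel_left]
        simp only at this
        linarith)
      have hs : s = 0 := by linarith
      simp only [hs, abs_zero] at h3
      linarith)
  obtain ⟨d, hd, hu⟩ := uniform_flow X (L + ρ) hm
  refine ⟨d, hd, fun p z hpz t s ht hs htK hsK => ?_⟩
  by_contra hlt
  have h1 := hmin (p, t, s) ⟨abs_le.1 ht, abs_le.1 hs, not_lt.1 hlt, htK⟩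
  have hts : |t + s| ≤ L + ρ := (abs_add_le t s).trans (by linarith)
  have h2 := hu (t + s) (t + s) hts hts (by simpa using hd) p z hpz
  have h3 := Metric.infDist_le_dist_of_mem (x := X (t + s) p) hsK
  simp only at h1
  linarith

/-! ### Return times and the gap -/

/-- A closed set `K` separated along orbits together with a closed subset `T` visited by every
orbit arc of length `L`. -/
structure Returning (X : Flow ℝ M) (K T : Set M) (g L : ℝ) : Prop where
  closedK : IsClosed K
  closedT : IsClosed T
  subset : T ⊆ K
  pos : 0 < g
  sep : Separated X K g
  visit : ∀ x, ∃ t ∈ Icc 0 L, X t x ∈ T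

theorem Returning.reverse {X : Flow ℝ M} {K T : Set M} {g L : ℝ} (h : Returning X K T g L) :
    Returning X.reverse K T g L where
  closedK := h.closedK
  closedT := h.closedT
  subset := h.subset
  pos := h.pos
  sep := h.sep.reverse
  visit x := by
    obtain ⟨t, ht, hx⟩ := h.visit (X (-L) x)
    refine ⟨L - t, ⟨by linarith [ht.2], by linarith [ht.1]⟩, ?_⟩
    rw [← Flow.map_add] at hx
    rw [Flow.reverse_apply]
    convert hx using 2
    ring

/-- Separation turns the condition 0 < t into the closed condition g ≤ t, so the infimum is
attained. The upper bound comes from a visit within time L after time g. -/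
theorem returnTime_spec {X : Flow ℝ M} {K : Set M} {g L : ℝ} {k : ℕ} {T : Fin k → Set M}
    (h : Returning X K (⋃ i, T i) g L) {p : M} (hp : p ∈ ⋃ i, T i) :
    g ≤ returnTime X T p ∧ returnTime X T p ≤ L + g ∧ firstReturn X T p ∈ ⋃ i, T i := by
  have hg := h.pos
  have hset : {t : ℝ | 0 < t ∧ X t p ∈ ⋃ i, T i} = {t : ℝ | g ≤ t ∧ X t p ∈ ⋃ i, T i} := by
    ext t
    constructor
    · rintro ⟨h0, ht⟩
      refine ⟨?_, ht⟩
      by_contra hlt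
      have := h.sep p (h.subset hp) t (by rw [abs_of_pos h0]; exact not_le.1 hlt) (h.subset ht)
      linarith
    · rintro ⟨h0, ht⟩
      exact ⟨by linarith, ht⟩
  obtain ⟨t, ht, hx⟩ := h.visit (X g p)
  rw [← Flow.map_add] at hx
  have hmem : t + g ∈ {t : ℝ | g ≤ t ∧ X t p ∈ ⋃ i, T i} := ⟨by linarith [ht.1], hx⟩
  have hbdd : BddBelow {t : ℝ | g ≤ t ∧ X t p ∈ ⋃ i, T i} := ⟨g, fun t ht => ht.1⟩
  have hcl : IsClosed {t : ℝ | g ≤ t ∧ X t p ∈ ⋃ i, T i} :=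
    IsClosed.and (isClosed_le (by fun_prop) (by fun_prop)) (h.closedT.preimage (by fun_prop))
  have hin := hcl.csInf_mem ⟨_, hmem⟩ hbdd
  have hle := csInf_le hbdd hmem
  have hrt : returnTime X T p = sInf {t : ℝ | g ≤ t ∧ X t p ∈ ⋃ i, T i} := by
    rw [returnTime, hset]
  rw [← hrt] at hin hle
  exact ⟨hin.1, hle.trans (by linarith [ht.2]), hin.2⟩

theorem iterate_firstReturn_mem {X : Flow ℝ M} {K : Set M} {g L : ℝ} {k : ℕ} {T : Fin k → Set M}
    (h : Returning X K (⋃ i, T i) g L) {p : M} (hp : p ∈ ⋃ i, T i) (n : ℕ) :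
    (firstReturn X T)^[n] p ∈ ⋃ i, T i := by
  induction n with
  | zero => exact hp
  | succ n ih =>
    rw [Function.iterate_succ_apply']
    exact (returnTime_spec h ih).2.2

theorem separated_gap {X : Flow ℝ M} {k : ℕ} {S : Fin k → Set M} :
    Separated X (⋃ i, S i) (gap X S) := by
  have key : ∀ x ∈ ⋃ i, S i, ∀ t : ℝ, 0 < t → t < gap X S → X t x ∉ ⋃ i, S i := by
    intro x hx t h0 ht hmem
    -- If no d qualifies, the gap is `sSup ∅ = 0` and no t lies below it.
    have hne : {d : ℝ | 0 < d ∧ ∀ x ∈ ⋃ i, S i,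
        flowImage X (Ioo 0 d) {x} ∩ (⋃ i, S i) = ∅}.Nonempty := by
      by_contra hne
      rw [gap, not_nonempty_iff_eq_empty.1 hne, Real.sSup_empty] at ht
      linarith
    obtain ⟨d, hd, htd⟩ := exists_lt_of_lt_csSup hne ht
    have := hd.2 x hx
    exact (eq_empty_iff_forall_notMem.1 this) (X t x) ⟨⟨t, ⟨h0, htd⟩, x, rfl, rfl⟩, hmem⟩
  intro x hx t ht hmem
  rcases lt_trichotomy t 0 with h | h | h
  · exfalso
    refine key _ hmem (-t) (by linarith) (by rwa [abs_of_neg h] at ht) ?_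
    rw [← Flow.map_add]
    simpa using hx
  · exact h
  · exact absurd hmem (key x hx t h (by rwa [abs_of_pos h] at ht))

theorem IsAdequatePair.returning {X : Flow ℝ M} {ε δ : ℝ} {k : ℕ} {S T : Fin k → Set M}
    (h : IsAdequatePair X ε δ S T) (hg : 0 < gap X S) :
    Returning X (⋃ i, S i) (⋃ i, T i) (gap X S) ε where
  closedK := isClosed_iUnion_of_finite fun i => (h.crossS i).isClosed
  closedT := isClosed_iUnion_of_finite fun i => (h.crossT i).isClosed
  subset := iUnion_mono fun i => (h.subset i).trans inter_subset_right
  pos := hg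
  sep := separated_gap
  visit x := by
    have : x ∈ ⋃ i, flowImage X (Icc (-ε) 0) (T i) := by rw [h.coverT']; exact mem_univ x
    obtain ⟨i, t, ht, y, hy, rfl⟩ := mem_iUnion.1 this
    refine ⟨-t, ⟨by linarith [ht.2], by linarith [ht.1]⟩, mem_iUnion.2 ⟨i, ?_⟩⟩
    rw [← Flow.map_add]
    simpa using hy

/-! ### Reparametrizations by interpolation -/

/-- The piecewise linear function taking the value `c n` at each integer `n`. -/
noncomputable def interp (c : ℤ → ℝ) (u : ℝ) : ℝ :=
  c ⌊u⌋ + Int.fract u * (c (⌊u⌋ + 1) - c ⌊u⌋)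

theorem interp_strictMono {c : ℤ → ℝ} (hc : StrictMono c) : StrictMono (interp c) := by
  intro u v huv
  have hu : 0 < c (⌊u⌋ + 1) - c ⌊u⌋ := sub_pos.2 (hc (lt_add_one _))
  have hv : 0 < c (⌊v⌋ + 1) - c ⌊v⌋ := sub_pos.2 (hc (lt_add_one _))
  rcases (Int.floor_mono huv.le).eq_or_lt with h | h
  · have : Int.fract u < Int.fract v := by
      simp only [Int.fract, h]
      linarith
    simp only [interp, ← h] at hv ⊢
    have := mul_lt_mul_of_pos_right this hu
    linarith
  · have h1 : c (⌊u⌋ + 1) ≤ c ⌊v⌋ := hc.monotone h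
    have h2 := mul_lt_mul_of_pos_right (Int.fract_lt_one u) hu
    have h3 := mul_nonneg (Int.fract_nonneg v) hv.le
    simp only [interp]
    linarith

theorem interp_surjective {c : ℤ → ℝ} (hc : StrictMono c) (hbot : ∀ v, ∃ n, c n ≤ v)
    (htop : ∀ v, ∃ n, v < c n) : Function.Surjective (interp c) := by
  intro v
  obtain ⟨N, hN⟩ := htop v
  obtain ⟨n, hn, hmax⟩ := Int.exists_greatest_of_bdd (P := fun n => c n ≤ v)
    ⟨N, fun z hz => (hc.lt_iff_lt.1 (lt_of_le_of_lt hz hN)).le⟩ (hbot v)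
  have hlt : v < c (n + 1) := by
    by_contra hle
    have := hmax (n + 1) (not_lt.1 hle)
    omega
  have hpos : 0 < c (n + 1) - c n := by linarith
  have h0 : 0 ≤ (v - c n) / (c (n + 1) - c n) := div_nonneg (by linarith) hpos.le
  have h1 : (v - c n) / (c (n + 1) - c n) < 1 := (div_lt_one hpos).2 (by linarith)
  refine ⟨n + (v - c n) / (c (n + 1) - c n), ?_⟩
  have hfl : ⌊(n : ℝ) + (v - c n) / (c (n + 1) - c n)⌋ = n :=
    Int.floor_eq_iff.2 ⟨by linarith, by linarith⟩
  rw [interp, Int.fract, hfl, add_sub_cancel_left, div_mul_cancel₀ _ hpos.ne']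
  ring

theorem interp_zero {c : ℤ → ℝ} (h0 : c 0 = 0) : interp c 0 = 0 := by simp [interp, h0]

/-- The homeomorphism of `ℝ` interpolating a sequence with increments bounded below. -/
noncomputable def interpHomeo (c : ℤ → ℝ) {ρ : ℝ} (hρ : 0 < ρ) (hc : ∀ n, ρ ≤ c (n + 1) - c n) :
    ℝ ≃ₜ ℝ :=
  have hmono : StrictMono c := strictMono_int_of_lt_succ fun n => by linarith [hc n]
  have hup : ∀ n : ℕ, c 0 + n * ρ ≤ c n := fun n => by
    induction n with
    | zero => simp
    | succ n ih =>
      have := hc n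
      push_cast
      linarith
  have hdown : ∀ n : ℕ, c (-n) ≤ c 0 - n * ρ := fun n => by
    induction n with
    | zero => simp
    | succ n ih =>
      have := hc (-(n + 1 : ℕ))
      rw [show (-((n + 1 : ℕ) : ℤ) + 1) = -n by push_cast; ring] at this
      push_cast at this ⊢
      linarith
  ((interp_strictMono hmono).orderIsoOfSurjective _ (interp_surjective hmono
    (fun v => by
      obtain ⟨n, hn⟩ := exists_nat_gt ((c 0 - v) / ρ)
      rw [div_lt_iff₀ hρ] at hn
      exact ⟨-n, by linarith [hdown n]⟩)
    (fun v => by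
      obtain ⟨n, hn⟩ := exists_nat_gt ((v - c 0) / ρ)
      rw [div_lt_iff₀ hρ] at hn
      exact ⟨n, by linarith [hup n]⟩))).toHomeomorph

theorem interpHomeo_apply (c : ℤ → ℝ) {ρ : ℝ} (hρ : 0 < ρ) (hc : ∀ n, ρ ≤ c (n + 1) - c n)
    (u : ℝ) : interpHomeo c hρ hc u = interp c u := rfl

/-- The reparametrization interpolating a family of time sequences. -/
noncomputable def interpReparam {A : Set M} (c : ℤ → A → ℝ) {ρ : ℝ} (hρ : 0 < ρ)
    (hc : ∀ n y, ρ ≤ c (n + 1) y - c n y) (h0 : ∀ y, c 0 y = 0) (hcont : ∀ n, Continuous (c n))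
    (x : A) : Reparam A where
  -- Time t on the guide orbit is converted to a parameter u that does not depend on y. Thus the
  -- guide gets the identity, and continuity in y involves only the sequences at ⌊u⌋ and ⌊u⌋ + 1.
  toHomeo y := (interpHomeo (fun n => c n x) hρ fun n => hc n x).symm.trans
    (interpHomeo (fun n => c n y) hρ fun n => hc n y)
  map_zero y := by
    have h1 : (interpHomeo (fun n => c n x) hρ fun n => hc n x).symm 0 = 0 := by
      rw [Homeomorph.symm_apply_eq, interpHomeo_apply, interp_zero (h0 x)]
    rw [Homeomorph.trans_apply, h1, interpHomeo_apply, interp_zero (h0 y)]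
  continuous_apply t := by
    simp only [Homeomorph.trans_apply, interpHomeo_apply, interp]
    have h1 := hcont ⌊(interpHomeo (fun n => c n x) hρ fun n => hc n x).symm t⌋
    have h2 := hcont (⌊(interpHomeo (fun n => c n x) hρ fun n => hc n x).symm t⌋ + 1)
    fun_prop
  guide := x
  guide_eq t := by simp

/-! ### From small iterates to reparametrizations -/

/-- The projection times are bounded by ρ with 2ρ < g, so `Separated.continuous` makes any choice of
them continuous. -/
theorem exists_step {X : Flow ℝ M} {g ρ : ℝ} {k : ℕ} {S T : Fin k → Set M}
    (hK : IsClosed (⋃ i, S i)) (hsep : Separated X (⋃ i, S i) g) (hρg : 2 * ρ < g)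
    {B : Set M} {p : M} (hB : StepDefined X ρ S T B p) {A : Type*} [TopologicalSpace A] {f : A → M}
    (hf : Continuous f) (hfB : ∀ a, f a ∈ B) :
    ∃ s : A → ℝ, Continuous s ∧ ∀ a, |s a| < ρ ∧
      X (returnTime X T p + s a) (f a) ∈ stepImage X ρ S T B p := by
  obtain ⟨l, hl, hsub⟩ := hB
  have hex : ∀ a, ∃ s : ℝ, |s| < ρ ∧ X s (X (returnTime X T p) (f a)) ∈ S l := by
    intro a
    obtain ⟨s, hs, z, hz, hzs⟩ := hsub (mem_image_of_mem _ (hfB a))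
    refine ⟨-s, by rw [abs_neg]; exact abs_lt.2 hs, ?_⟩
    rw [← hzs, ← Flow.map_add]
    simpa using hz
  choose s hs hsS using hex
  refine ⟨s, hsep.continuous hK hρg (f := fun a => X (returnTime X T p) (f a)) (by fun_prop)
    (fun a => (hs a).le) (fun a => mem_iUnion.2 ⟨l, hsS a⟩), fun a => ⟨hs a, l, hl, ?_⟩⟩
  rw [add_comm, Flow.map_add]
  exact ⟨hsS a, _, mem_image_of_mem _ (hfB a), s a, hs a, rfl⟩

theorem iterNat_subset {X : Flow ℝ M} {ρ : ℝ} {k : ℕ} {S T : Fin k → Set M} {A : Set M}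
    (hA : A ⊆ ⋃ i, S i) (x : M) (n : ℕ) : iterNat X ρ S T A x n ⊆ ⋃ i, S i := by
  cases n with
  | zero => exact hA
  | succ n =>
    rintro z ⟨l, -, hz, -⟩
    exact mem_iUnion.2 ⟨l, hz⟩

theorem firstReturn_mem_stepImage {X : Flow ℝ M} {ρ : ℝ} (hρ : 0 < ρ) {k : ℕ}
    {S T : Fin k → Set M} (hTS : ∀ i, T i ⊆ S i) {B : Set M} {p : M} (hp : p ∈ B)
    (h : firstReturn X T p ∈ ⋃ i, T i) : firstReturn X T p ∈ stepImage X ρ S T B p := by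
  obtain ⟨l, hl⟩ := mem_iUnion.1 h
  exact ⟨l, hl, hTS l hl, _, mem_image_of_mem _ hp, 0, by simpa using hρ, by simp [firstReturn]⟩

theorem iterate_mem_iterNat {X : Flow ℝ M} {ρ : ℝ} (hρ : 0 < ρ) {k : ℕ} {S T : Fin k → Set M}
    {g L : ℝ} (h : Returning X (⋃ i, S i) (⋃ i, T i) g L)
    (hTS : ∀ i, T i ⊆ S i) {A : Set M} {x : M} (hxA : x ∈ A) (hx : x ∈ ⋃ i, T i) (n : ℕ) :
    (firstReturn X T)^[n] x ∈ iterNat X ρ S T A x n := by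
  induction n with
  | zero => exact hxA
  | succ n ih =>
    rw [Function.iterate_succ_apply']
    exact firstReturn_mem_stepImage hρ hTS ih
      (returnTime_spec h (iterate_firstReturn_mem h hx n)).2.2

/-- The points of a continuum whose forward iterates are defined and small visit the iterates at
times depending continuously on the point, with nearly equal increments. -/
theorem exists_visit_times [CompactSpace M] {X : Flow ℝ M} {ρ : ℝ} (hρ : 0 < ρ) {k : ℕ}
    {S T : Fin k → Set M} {g L : ℝ} (h : Returning X (⋃ i, S i) (⋃ i, T i) g L)
    (hTS : ∀ i, T i ⊆ S i) (hρg : 2 * ρ < g) {κ : ℝ} (hκ : 0 < κ) :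
    ∃ η₀ > 0, ∀ η ≤ η₀, ∀ (A : Set M) (x : M), A ⊆ ⋃ i, S i → x ∈ A → x ∈ ⋃ i, T i →
      (∀ n, IterNatDefined X ρ S T A x n ∧ Metric.diam (iterNat X ρ S T A x n) < η) →
      ∃ (c : ℕ → A → ℝ) (t : ℕ → ℝ), (∀ y, c 0 y = 0) ∧ (∀ n, Continuous (c n)) ∧
        (∀ n, g ≤ t n ∧ t n ≤ L + g) ∧ (∀ n y, |c (n + 1) y - c n y - t n| < κ) ∧
        ∀ n y z, dist (X (c n y) (y : M)) (X (c n z) (z : M)) < η := by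
  obtain ⟨η₀, hη₀, hu⟩ := h.sep.uniform h.closedK (ρ := ρ) (by linarith) (L + g) hκ
  refine ⟨η₀, hη₀, fun η hη A x hA hxA hx hit => ?_⟩
  -- Continuous times carrying every point of A into the n-th iterate. They are chosen recursively,
  -- each extending the previous one by a return time plus a projection time.
  let G (n : ℕ) : Type _ := {c : A → ℝ // Continuous c ∧
    ∀ y : A, X (c y) (y : M) ∈ iterNat X ρ S T A x n}
  have hstep : ∀ n, ∀ c : G n, ∃ c' : G (n + 1), ∀ y,
      |c'.1 y - c.1 y - returnTime X T ((firstReturn X T)^[n] x)| < ρ := by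
    rintro n ⟨c, hc, hcm⟩
    obtain ⟨s, hs, hs'⟩ := exists_step h.closedK h.sep hρg ((hit (n + 1)).1 n (Nat.lt_succ_self n))
      (A := A) (f := fun y => X (c y) (y : M)) (by fun_prop) hcm
    refine ⟨⟨fun y => returnTime X T ((firstReturn X T)^[n] x) + s y + c y, by fun_prop,
      fun y => ?_⟩, fun y => ?_⟩
    · rw [Flow.map_add]
      exact (hs' y).2
    · have := (hs' y).1
      convert this using 2
      ring
  choose next hnext using hstep
  let c : ∀ n, G n := fun n => Nat.rec (motive := G)
    ⟨fun _ => 0, continuous_const, fun y => by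
      rw [Flow.map_zero_apply]
      exact y.2⟩ (fun n c => next n c) n
  have hdist : ∀ n, ∀ a ∈ iterNat X ρ S T A x n, ∀ b ∈ iterNat X ρ S T A x n, dist a b < η :=
    fun n a ha b hb => (Metric.dist_le_diam_of_mem (Metric.isBounded_of_compactSpace) ha hb).trans_lt
      (hit n).2
  refine ⟨fun n => (c n).1, fun n => returnTime X T ((firstReturn X T)^[n] x), fun y => rfl,
    fun n => (c n).2.1, fun n => ?_, fun n y => ?_, fun n y z =>
      hdist n _ ((c n).2.2 y) _ ((c n).2.2 z)⟩
  · have := returnTime_spec h (iterate_firstReturn_mem h hx n)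
    exact ⟨this.1, this.2.1⟩
  · have hr := returnTime_spec h (iterate_firstReturn_mem h hx n)
    have hg := h.pos
    -- The projection times are only known to be below ρ. Comparison with the orbit of x, which
    -- needs no projection, improves this to κ through `Separated.uniform`.
    refine hu _ _ ((hdist n _ (iterate_mem_iterNat hρ h hTS hxA hx n) _ ((c n).2.2 y)).trans_le hη)
      _ _ (by rw [abs_of_nonneg (by linarith)]; exact hr.2.1) (hnext n (c n) y).le
      (h.subset hr.2.2) ?_
    rw [← Flow.map_add]
    have : returnTime X T ((firstReturn X T)^[n] x) + ((c (n + 1)).1 y - (c n).1 y -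
      returnTime X T ((firstReturn X T)^[n] x)) + (c n).1 y = (c (n + 1)).1 y := by ring
    change X (returnTime X T ((firstReturn X T)^[n] x) + ((c (n + 1)).1 y - (c n).1 y -
      returnTime X T ((firstReturn X T)^[n] x)) + (c n).1 y) (y : M) ∈ _
    rw [this]
    exact iterNat_subset hA x _ ((c (n + 1)).2.2 y)

theorem IsAdequatePair.subset' {X : Flow ℝ M} {ε δ : ℝ} {k : ℕ} {S T : Fin k → Set M}
    (h : IsAdequatePair X ε δ S T) (i : Fin k) : T i ⊆ S i :=
  (h.subset i).trans inter_subset_right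

/-- The continua that are both stable and unstable at a small enough scale carry
reparametrizations along which the flow keeps them small. -/
theorem exists_reparam [CompactSpace M] {X : Flow ℝ M} {ρ : ℝ} (hρ : 0 < ρ) {k : ℕ}
    {S T : Fin k → Set M} {g L : ℝ} (h : Returning X (⋃ i, S i) (⋃ i, T i) g L)
    (hTS : ∀ i, T i ⊆ S i) (hρg : 2 * ρ < g) {d : ℝ} (hd : 0 < d) :
    ∃ η₀ > 0, ∀ η ≤ η₀, ∀ A ∈ stableSet X ρ S T η ∩ unstableSet X ρ S T η, ∀ x : A,
      ∃ α : Reparam A, α.guide = x ∧ ∀ t : ℝ, Metric.diam (α.image X t) < d := by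
  have hg := h.pos
  obtain ⟨d₀, hd₀, hu⟩ := uniform_flow X (L + 2 * g) (half_pos hd)
  -- κ < g/2 keeps every increment at least g/2; κ < d₀/2 keeps the increments of two points within
  -- d₀ of each other.
  obtain ⟨κ, hκ, hκ'⟩ : ∃ κ, 0 < κ ∧ κ < min (g / 2) (d₀ / 2) :=
    exists_between (lt_min (half_pos hg) (half_pos hd₀))
  rw [lt_min_iff] at hκ'
  obtain ⟨η₁, hη₁, h₁⟩ := exists_visit_times hρ h hTS hρg hκ
  obtain ⟨η₂, hη₂, h₂⟩ := exists_visit_times hρ h.reverse hTS hρg hκ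
  refine ⟨min d₀ (min η₁ η₂), lt_min hd₀ (lt_min hη₁ hη₂), fun η hη A hA x => ?_⟩
  simp only [le_min_iff] at hη
  obtain ⟨⟨-, -, j, hj, x₁, hx₁, hs⟩, -, -, j', -, x₂, hx₂, hs'⟩ := hA
  have hAS : A ⊆ ⋃ i, S i := hj.trans (subset_iUnion S j)
  obtain ⟨c₁, t₁, hc₁, hcont₁, ht₁, hκ₁, hη₁'⟩ := h₁ η hη.2.1 A x₁ hAS hx₁.1
    (mem_iUnion.2 ⟨_, hx₁.2⟩) (fun n => hs n (Int.natCast_nonneg n))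
  obtain ⟨c₂, t₂, hc₂, hcont₂, ht₂, hκ₂, hη₂'⟩ := h₂ η hη.2.2 A x₂ hAS hx₂.1
    (mem_iUnion.2 ⟨_, hx₂.2⟩) (fun n => by
      cases n with
      -- Index 0 of `iterSet` is a forward iterate, but in both directions the zeroth iterate is A.
      | zero => exact ⟨fun m hm => absurd hm (Nat.not_lt_zero m), (hs' 0 le_rfl).2⟩
      | succ n => exact hs' (Int.negSucc n) (Int.negSucc_lt_zero n).le)
  -- Forward visit times, continued by the negatives of those of the reversed flow. The base points
  -- x₁ and x₂ may differ: both sequences start at time 0 on all of A.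
  let c : ℤ → A → ℝ := fun n y => if 0 ≤ n then c₁ n.toNat y else -c₂ (-n).toNat y
  have hcp : ∀ (n : ℕ) y, c n y = c₁ n y := fun n y => by simp [c]
  have hcm : ∀ (n : ℕ) y, c (-n) y = -c₂ n y := fun n y => by
    cases n with
    | zero => simp [c, hc₁, hc₂]
    | succ n =>
      have hneg : ¬ (0 : ℤ) ≤ -((n + 1 : ℕ) : ℤ) := by omega
      simp only [c, if_neg hneg, neg_neg, Int.toNat_natCast]
  have hcases : ∀ n : ℤ, (∃ m : ℕ, n = m) ∨ ∃ m : ℕ, n = -(m + 1 : ℕ) := fun n => by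
    rcases le_or_gt 0 n with hn | hn
    · exact Or.inl ⟨n.toNat, by omega⟩
    · exact Or.inr ⟨(-n - 1).toNat, by omega⟩
  have hsucc : ∀ m : ℕ, -((m + 1 : ℕ) : ℤ) + 1 = -(m : ℤ) := fun m => by push_cast; ring
  have hcont : ∀ n, Continuous (c n) := fun n => by
    rcases hcases n with ⟨m, rfl⟩ | ⟨m, rfl⟩
    · rw [show c m = c₁ m from funext (hcp m)]
      exact hcont₁ m
    · rw [show c (-(m + 1 : ℕ)) = fun y => -c₂ (m + 1) y from funext (hcm (m + 1))]
      exact (hcont₂ (m + 1)).neg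
  have hincr : ∀ n, ∃ t, g ≤ t ∧ t ≤ L + g ∧ ∀ y, |c (n + 1) y - c n y - t| < κ := fun n => by
    rcases hcases n with ⟨m, rfl⟩ | ⟨m, rfl⟩
    · refine ⟨t₁ m, (ht₁ m).1, (ht₁ m).2, fun y => ?_⟩
      have := hκ₁ m y
      rw [← hcp, ← hcp] at this
      exact_mod_cast this
    · refine ⟨t₂ m, (ht₂ m).1, (ht₂ m).2, fun y => ?_⟩
      rw [hsucc, hcm, hcm]
      have := hκ₂ m y
      convert this using 2
      ring
  have hclose : ∀ n y z, dist (X (c n y) (y : M)) (X (c n z) (z : M)) < η := fun n y z => by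
    rcases hcases n with ⟨m, rfl⟩ | ⟨m, rfl⟩
    · rw [hcp, hcp]
      exact hη₁' m y z
    · rw [hcm, hcm]
      exact hη₂' (m + 1) y z
  have hmin : ∀ n y, g / 2 ≤ c (n + 1) y - c n y := fun n y => by
    obtain ⟨t, ht, -, hty⟩ := hincr n
    have := (abs_lt.1 (hty y)).1
    linarith [hκ'.1]
  refine ⟨interpReparam c (half_pos hg) hmin (fun y => (hcp 0 y).trans (hc₁ y)) hcont x, rfl,
    fun t => ?_⟩
  refine (Metric.diam_le_of_forall_dist_le (half_pos hd).le ?_).trans_lt (half_lt_self hd)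
  rintro _ ⟨y, rfl⟩ _ ⟨z, rfl⟩
  set u := (interpHomeo (fun n => c n x) (half_pos hg) fun n => hmin n x).symm t
  change dist (X (interp (fun n => c n y) u) (y : M)) (X (interp (fun n => c n z) u) (z : M)) ≤ d / 2
  simp only [interp]
  obtain ⟨τ, hτ, hτ', hτy⟩ := hincr ⌊u⌋
  have hθ0 := Int.fract_nonneg u
  have hθ1 := (Int.fract_lt_one u).le
  have hb : ∀ y, |Int.fract u * (c (⌊u⌋ + 1) y - c ⌊u⌋ y)| ≤ L + 2 * g := fun y => by
    have h1 := abs_lt.1 (hτy y)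
    rw [abs_mul, abs_of_nonneg hθ0, abs_of_nonneg (by linarith)]
    have h2 := mul_le_mul_of_nonneg_right hθ1 (a := c (⌊u⌋ + 1) y - c ⌊u⌋ y) (by linarith)
    linarith
  have hdiff : |Int.fract u * (c (⌊u⌋ + 1) y - c ⌊u⌋ y) -
      Int.fract u * (c (⌊u⌋ + 1) z - c ⌊u⌋ z)| < d₀ := by
    rw [← mul_sub, abs_mul, abs_of_nonneg hθ0]
    have h1 := abs_lt.1 (hτy y)
    have h2 := abs_lt.1 (hτy z)
    have h3 : |c (⌊u⌋ + 1) y - c ⌊u⌋ y - (c (⌊u⌋ + 1) z - c ⌊u⌋ z)| < d₀ :=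
      abs_lt.2 ⟨by linarith, by linarith⟩
    exact (mul_le_of_le_one_left (abs_nonneg _) hθ1).trans_lt h3
  rw [add_comm (c ⌊u⌋ y), Flow.map_add, add_comm (c ⌊u⌋ z), Flow.map_add]
  exact (hu _ _ (hb y) (hb z) hdiff _ _ ((hclose _ y z).trans_le hη.1)).le

/-! ### Expansiveness implies the section condition -/

/-- By separation, a point already on a section is its own projection, so the iterates of {x} just
follow the orbit of x. -/
theorem iterNat_singleton {X : Flow ℝ M} {ρ : ℝ} (hρ : 0 < ρ) {k : ℕ} {S T : Fin k → Set M}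
    {g L : ℝ} (h : Returning X (⋃ i, S i) (⋃ i, T i) g L) (hTS : ∀ i, T i ⊆ S i)
    (hρg : 2 * ρ < g) {x : M} (hx : x ∈ ⋃ i, T i) (n : ℕ) :
    IterNatDefined X ρ S T {x} x n ∧ (iterNat X ρ S T {x} x n).Subsingleton := by
  have hsub : ∀ n, iterNat X ρ S T {x} x n ⊆ {(firstReturn X T)^[n] x} := by
    intro n
    induction n with
    | zero => exact subset_rfl
    | succ n ih =>
      rintro z ⟨l, hl, hz, _, ⟨w, hw, rfl⟩, s, hs, rfl⟩
      rw [ih hw] at hz ⊢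
      have hs0 : s = 0 := h.sep _ (h.subset (mem_iUnion.2 ⟨l, hl⟩)) s (by linarith [abs_nonneg s])
        (mem_iUnion.2 ⟨l, hz⟩)
      rw [Function.iterate_succ_apply', hs0, Flow.map_zero_apply]
      rfl
  refine ⟨fun m _ => ?_, subsingleton_singleton.anti (hsub n)⟩
  obtain ⟨l, hl⟩ := mem_iUnion.1 (returnTime_spec h (iterate_firstReturn_mem h hx m)).2.2
  refine ⟨l, hl, ?_⟩
  rintro _ ⟨w, hw, rfl⟩
  rw [hsub m hw]
  exact ⟨0, ⟨by linarith, hρ⟩, _, hTS l hl, Flow.map_zero_apply _ _⟩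

theorem IsCwExpansive.exists_eta [CompactSpace M] {X : Flow ℝ M} (hX : IsCwExpansive X)
    {ε δ : ℝ} {k : ℕ} {S T : Fin k → Set M} (hST : IsAdequatePair X ε δ S T) {ρ ε₀ : ℝ}
    (had : Admissible X ε δ S T ρ ε₀) :
    ∃ η : ℝ, 0 < η ∧ η < ε₀ ∧ stableSet X ρ S T η ∩ unstableSet X ρ S T η =
      {A : Set M | ∃ x ∈ ⋃ i, T i, A = {x}} := by
  have hρ := had.rho_pos
  have hρg := had.rho_lt_gap
  have hg : 0 < gap X S := by linarith
  have h := hST.returning hg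
  -- Expansiveness at scale `gap X S`: the resulting orbit arc around x meets the sections only in
  -- x.
  obtain ⟨d, hd, hcw⟩ := hX _ hg
  obtain ⟨η₀, hη₀, hrep⟩ := exists_reparam hρ h hST.subset' hρg hd
  obtain ⟨η, hη, hη'⟩ : ∃ η, 0 < η ∧ η < min η₀ ε₀ := exists_between (lt_min hη₀ had.eps_pos)
  rw [lt_min_iff] at hη'
  refine ⟨η, hη, hη'.2, subset_antisymm ?_ ?_⟩
  · intro A hA
    obtain ⟨hAc, hAconn, j, hj, x, hx, -⟩ := hA.1
    refine ⟨x, mem_iUnion.2 ⟨j, hx.2⟩, subset_antisymm ?_ (singleton_subset_iff.2 hx.1)⟩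
    obtain ⟨α, hα, hdiam⟩ := hrep η hη'.1.le A hA ⟨x, hx.1⟩
    intro y hy
    obtain ⟨t, ht, _, hz, hty⟩ := hcw A hAc hAconn α hdiam hy
    rw [hα] at hz
    rw [mem_singleton_iff.1 hz] at hty
    have ht0 : t = 0 := h.sep x (mem_iUnion.2 ⟨j, hj hx.1⟩) t (abs_lt.2 ht)
      (by rw [hty]; exact mem_iUnion.2 ⟨j, hj hy⟩)
    rw [ht0, Flow.map_zero_apply] at hty
    exact hty.symm
  · rintro _ ⟨x, hx, rfl⟩
    obtain ⟨j, hj⟩ := mem_iUnion.1 hx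
    have hS : ({x} : Set M) ⊆ S j := singleton_subset_iff.2 (hST.subset' j hj)
    refine ⟨⟨isCompact_singleton, isConnected_singleton, j, hS, x, ⟨rfl, hj⟩, fun n _ => ?_⟩,
      ⟨isCompact_singleton, isConnected_singleton, j, hS, x, ⟨rfl, hj⟩, fun n _ => ?_⟩⟩ <;>
    cases n with
    | ofNat n =>
      have := iterNat_singleton hρ h hST.subset' hρg hx n
      exact ⟨this.1, (Metric.diam_subsingleton this.2).trans_lt hη⟩
    | negSucc n =>
      have := iterNat_singleton hρ h.reverse hST.subset' hρg hx (n + 1)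
      exact ⟨this.1, (Metric.diam_subsingleton this.2).trans_lt hη⟩

/-! ### Absence of short periods and of drift -/

theorem map_int_mul_period {X : Flow ℝ M} {x : M} {t : ℝ} (h : X t x = x) (k : ℤ) :
    X (k * t) x = x := by
  have h' : X (-t) x = x := by
    conv_lhs => rw [← h]
    rw [← Flow.map_add]
    simp
  induction k using Int.induction_on with
  | zero => simp
  | succ k ih =>
    rw [show (((k : ℤ) + 1 : ℤ) : ℝ) * t = ((k : ℤ) : ℝ) * t + t by push_cast; ring, Flow.map_add, h]
    exact ih
  | pred k ih =>
    rw [show ((-(k : ℤ) - 1 : ℤ) : ℝ) * t = ((-(k : ℤ) : ℤ) : ℝ) * t + -t by push_cast; ring,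
      Flow.map_add, h']
    exact ih

/-- A flow without fixed points has no short periods. -/
theorem exists_no_short_period [CompactSpace M] {X : Flow ℝ M} (hX : ∀ x, ∃ t, X t x ≠ x) :
    ∃ c > 0, ∀ x, ∀ t : ℝ, |t| ≤ c → X t x = x → t = 0 := by
  have key : ∀ᶠ t : ℝ in 𝓝 0, ∀ x ∈ (univ : Set M), 0 < t → X t x ≠ x := by
    refine isCompact_univ.eventually_forall_of_forall_eventually
      (P := fun t x => 0 < t → X t x ≠ x) fun x _ => ?_
    obtain ⟨s, hs⟩ := hX x
    have h1 : ∀ᶠ z : ℝ × M in 𝓝 (0, x), dist (X z.1 z.2) z.2 < dist (X s z.2) z.2 := by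
      refine ContinuousAt.eventually_lt (Continuous.continuousAt (by fun_prop))
        (Continuous.continuousAt (by fun_prop)) ?_
      simpa using hs
    obtain ⟨r, hr, hball⟩ := Metric.eventually_nhds_iff.1 h1
    refine Metric.eventually_nhds_iff.2 ⟨r, hr, ?_⟩
    rintro ⟨t, y⟩ hz (ht : 0 < t) (hper : X t y = y)
    rw [Prod.dist_eq, max_lt_iff] at hz
    -- Reducing s modulo the period t gives a time in [0, t), too short to move y as far as `X s`
    -- does.
    obtain ⟨k, hk, -⟩ := existsUnique_add_zsmul_mem_Ico ht s 0
    rw [zsmul_eq_mul, zero_add] at hk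
    have h2 := hball (y := (s + k * t, y)) (by
      rw [Prod.dist_eq, max_lt_iff]
      refine ⟨?_, hz.2⟩
      have h3 := hz.1
      simp only [Real.dist_eq, sub_zero] at h3 ⊢
      rw [abs_of_pos ht] at h3
      rw [abs_of_nonneg hk.1]
      exact hk.2.trans h3)
    rw [Flow.map_add, map_int_mul_period hper] at h2
    exact lt_irrefl _ h2
  obtain ⟨c, hc, hball⟩ := Metric.eventually_nhds_iff.1 key
  refine ⟨c / 2, half_pos hc, fun x t ht hper => ?_⟩
  have hlt : |t| < c := ht.trans_lt (half_lt_self hc)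
  rcases lt_trichotomy t 0 with h | h | h
  · exfalso
    refine hball (y := -t) (by simpa [Real.dist_eq] using hlt) x (mem_univ x) (by linarith) ?_
    conv_lhs => rw [← hper]
    rw [← Flow.map_add]
    simp
  · exact h
  · exact absurd hper (hball (y := t) (by simpa [Real.dist_eq] using hlt) x (mem_univ x) h)

/-- In a flow without short periods, a reparametrized orbit arc shadowing an orbit arc keeps nearly
the same parametrization. -/
theorem exists_drift [CompactSpace M] {X : Flow ℝ M} {c : ℝ}
    (hc : 0 < c) (hper : ∀ x, ∀ t : ℝ, |t| ≤ c → X t x = x → t = 0) (L : ℝ) {κ : ℝ} (hκ : 0 < κ) :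
    ∃ d > 0, ∀ (p q : M) (u : ℝ → ℝ), Continuous u → u 0 = 0 →
      (∀ t ∈ Icc 0 L, dist (X (u t) q) (X t p) < d) → ∀ t ∈ Icc 0 L, |u t - t| < κ := by
  set κ' := min κ c
  have hκ' : 0 < κ' := lt_min hκ hc
  have hC : IsCompact ((univ : Set M) ×ˢ {v : ℝ | |v| = κ'}) := by
    refine isCompact_univ.prod (isCompact_Icc (a := -κ') (b := κ') |>.of_isClosed_subset
      (isClosed_eq (by fun_prop) (by fun_prop)) ?_)
    intro v hv
    exact abs_le.1 (le_of_eq hv)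
  obtain ⟨m, hm, hmin⟩ := hC.exists_forall_le' (a := 0)
    (f := fun z : M × ℝ => dist (X z.2 z.1) z.1) (by fun_prop) (by
      rintro ⟨x, v⟩ ⟨-, hv⟩
      refine dist_pos.2 fun h => ?_
      have hv' : |v| = κ' := hv
      have := hper x v (hv'.le.trans (min_le_right _ _)) h
      rw [this, abs_zero] at hv'
      linarith)
  obtain ⟨d, hd, hu⟩ := uniform_flow X L (half_pos hm)
  refine ⟨min d (m / 2), lt_min hd (half_pos hm), fun p q u hcont h0 hclose t ht => ?_⟩
  by_contra hlt
  have hpq : dist p q < d := by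
    have := hclose 0 ⟨le_rfl, ht.1.trans ht.2⟩
    rw [h0, Flow.map_zero_apply, Flow.map_zero_apply, dist_comm] at this
    exact this.trans_le (min_le_left _ _)
  -- A drift reaching κ passes through κ' ≤ c at some time r. Then `X (u r) q` and `X r q` are at
  -- least m apart, yet both lie within m/2 of `X r p`.
  obtain ⟨r, hr, hre⟩ := intermediate_value_Icc ht.1 (f := fun t => |u t - t|)
    (by fun_prop) (a := 0) (show κ' ∈ _ from ⟨by simpa [h0] using hκ'.le,
      (min_le_left _ _).trans (not_lt.1 hlt)⟩)
  have hrL : r ∈ Icc 0 L := ⟨hr.1, hr.2.trans ht.2⟩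
  have habs : |r| ≤ L := by rw [abs_of_nonneg hrL.1]; exact hrL.2
  have h1 := hu r r habs habs (by simpa using hd) p q hpq
  have h2 := (hclose r hrL).trans_le (min_le_right _ _)
  have h3 := hmin (X r q, u r - r) ⟨mem_univ _, hre⟩
  simp only [← Flow.map_add, sub_add_cancel] at h3
  have := dist_triangle (X (u r) q) (X r p) (X r q)
  linarith

/-! ### The section condition implies expansiveness -/

/-- Points close to `T i` lie close, along the flow, to `S i`. -/
def Reaches (X : Flow ℝ M) {k : ℕ} (S T : Fin k → Set M) : Prop :=
  ∀ κ > 0, ∃ r > 0, ∀ i, ∀ x ∈ T i, ∀ w, dist w x < r → ∃ s : ℝ, |s| < κ ∧ X s w ∈ S i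

theorem Reaches.reverse {X : Flow ℝ M} {k : ℕ} {S T : Fin k → Set M} (h : Reaches X S T) :
    Reaches X.reverse S T := fun κ hκ => by
  obtain ⟨r, hr, hS⟩ := h κ hκ
  refine ⟨r, hr, fun i x hx w hw => ?_⟩
  obtain ⟨s, hs, hsS⟩ := hS i x hx w hw
  exact ⟨-s, by rwa [abs_neg], by simpa using hsS⟩

/-- The iterates of a set whose points start on orbits shadowing that of `x` stay defined and
small. -/
theorem exists_shadow_iterates [CompactSpace M] {X : Flow ℝ M} {c : ℝ} (hc : 0 < c)
    (hper : ∀ x, ∀ t : ℝ, |t| ≤ c → X t x = x → t = 0) {ρ : ℝ} (hρ : 0 < ρ) {k : ℕ}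
    {S T : Fin k → Set M} {g L : ℝ} (h : Returning X (⋃ i, S i) (⋃ i, T i) g L)
    (hreach : Reaches X S T) (hρg : 2 * ρ < g) {η : ℝ} (hη : 0 < η) :
    ∃ κ₀ > 0, ∀ κ, 0 < κ → κ ≤ κ₀ → ∃ d₀ > 0, ∀ d ≤ d₀, ∀ {ι : Type*} (z : ι → M)
      (a : ι → ℝ → ℝ), (∀ y, Continuous (a y)) → ∀ x ∈ ⋃ i, T i,
      (∀ y, ∀ t, 0 ≤ t → dist (X (a y t) (z y)) (X t x) < d) →
      ∀ B : Set M, (∀ b ∈ B, ∃ y s, |s - a y 0| < κ ∧ X s (z y) = b) →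
        ∀ n, IterNatDefined X ρ S T B x n ∧ Metric.diam (iterNat X ρ S T B x n) < η := by
  have hg := h.pos
  obtain ⟨r₀, hr₀, hS₀⟩ := hreach ρ hρ
  obtain ⟨r₁, hr₁, hu₁⟩ := uniform_flow X (L + g) hr₀
  set r := min (η / 3) r₁
  have hr : 0 < r := lt_min (by linarith) hr₁
  obtain ⟨d₁, hd₁, hu⟩ := uniform_flow X 1 hr
  -- Three errors of size κ and one projection time below ρ < g/2 must add up to less than g.
  refine ⟨min (g / 6) (min d₁ 1), lt_min (by linarith) (lt_min hd₁ one_pos), fun κ hκ hκ₀ => ?_⟩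
  simp only [le_min_iff] at hκ₀
  obtain ⟨d₂, hd₂, hdrift⟩ := exists_drift hc hper (L + g) hκ
  obtain ⟨d₃, hd₃, hS⟩ := hreach κ hκ
  refine ⟨min d₁ (min d₂ d₃), lt_min hd₁ (lt_min hd₂ hd₃), fun d hd ι z a ha x hx hclose B hB => ?_⟩
  simp only [le_min_iff] at hd
  -- τ is the time of the n-th return of x. Each point of the n-th iterate lies on a shadowing
  -- orbit, within κ of the shadowing time.
  let Inv (n : ℕ) (τ : ℝ) : Prop := 0 ≤ τ ∧ X τ x = (firstReturn X T)^[n] x ∧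
    ∀ b ∈ iterNat X ρ S T B x n, ∃ y s, |s - a y τ| < κ ∧ X s (z y) = b
  have hnear : ∀ n τ, Inv n τ → ∀ b ∈ iterNat X ρ S T B x n,
      dist b ((firstReturn X T)^[n] x) < r := by
    rintro n τ ⟨hτ, hτx, hτB⟩ b hb
    obtain ⟨y, s, hs, rfl⟩ := hτB b hb
    have h1 := hu (s - a y τ) 0 (by linarith) (by simp) (by rw [sub_zero]; linarith)
      (X (a y τ) (z y)) ((firstReturn X T)^[n] x) (by rw [← hτx]; exact (hclose y τ hτ).trans_le hd.1)
    rwa [← Flow.map_add, sub_add_cancel, Flow.map_zero_apply] at h1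
  have hdef : ∀ n τ, Inv n τ →
      StepDefined X ρ S T (iterNat X ρ S T B x n) ((firstReturn X T)^[n] x) := by
    intro n τ hInv
    obtain ⟨h1, h2, h3⟩ := returnTime_spec h (iterate_firstReturn_mem h hx n)
    obtain ⟨l, hl⟩ := mem_iUnion.1 h3
    refine ⟨l, hl, ?_⟩
    rintro _ ⟨b, hb, rfl⟩
    have habs : |returnTime X T ((firstReturn X T)^[n] x)| ≤ L + g := by
      rwa [abs_of_nonneg (by linarith)]
    have h4 := hu₁ _ _ habs habs (by simpa using hr₁) b _
      ((hnear n τ hInv b hb).trans_le (min_le_right _ _))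
    obtain ⟨s, hs, hsS⟩ := hS₀ l _ hl _ h4
    refine ⟨-s, ⟨by linarith [(abs_lt.1 hs).2], by linarith [(abs_lt.1 hs).1]⟩, _, hsS, ?_⟩
    rw [← Flow.map_add]
    simp
  have hstep : ∀ n τ, Inv n τ → Inv (n + 1) (τ + returnTime X T ((firstReturn X T)^[n] x)) := by
    rintro n τ ⟨hτ, hτx, hτB⟩
    obtain ⟨h1, h2, h3⟩ := returnTime_spec h (iterate_firstReturn_mem h hx n)
    set t := returnTime X T ((firstReturn X T)^[n] x) with ht
    have hX : X (τ + t) x = firstReturn X T ((firstReturn X T)^[n] x) := by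
      rw [add_comm, Flow.map_add, hτx]
      rfl
    refine ⟨by linarith, by rw [Function.iterate_succ_apply', hX], ?_⟩
    rintro w ⟨l, hl, hw, _, ⟨b, hb, rfl⟩, s', hs', rfl⟩
    obtain ⟨y, s, hs, rfl⟩ := hτB b hb
    rw [← ht, ← Flow.map_add, ← Flow.map_add] at hw ⊢
    have h4 := hclose y (τ + t) (by linarith)
    rw [hX] at h4
    obtain ⟨s'', hs'', hsS⟩ := hS l _ hl _ (h4.trans_le hd.2.2)
    rw [← Flow.map_add] at hsS
    have h5 := hdrift (X τ x) (X (a y τ) (z y)) (fun r => a y (τ + r) - a y τ)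
      (((ha y).comp (by fun_prop)).sub continuous_const) (by simp) (by
        intro r hr
        rw [← Flow.map_add, ← Flow.map_add, sub_add_cancel, add_comm r]
        exact (hclose y (τ + r) (by linarith [hr.1])).trans_le hd.2.1) t ⟨by linarith, h2⟩
    -- Two hitting times of the sections on one orbit: that of the projection, and that given by
    -- closeness to T l. They differ by less than ρ + 3κ, so they coincide. The error is thus again
    -- |s''| < κ and does not accumulate.
    have heq : s' + (t + s) = s'' + a y (τ + t) := by
      refine h.sep.eq ?_ (mem_iUnion.2 ⟨l, hsS⟩) ?_
      · rw [← add_assoc]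
        exact mem_iUnion.2 ⟨l, hw⟩
      · rw [abs_lt] at *
        constructor <;> linarith
    refine ⟨y, s' + (t + s), ?_, by rw [← add_assoc]⟩
    rw [heq, add_sub_cancel_right]
    exact hs''
  have hInv : ∀ n, ∃ τ, Inv n τ := by
    intro n
    induction n with
    | zero => exact ⟨0, le_rfl, Flow.map_zero_apply _ _, hB⟩
    | succ n ih =>
      obtain ⟨τ, hτ⟩ := ih
      exact ⟨_, hstep n τ hτ⟩
  intro n
  refine ⟨fun m _ => ?_, ?_⟩
  · obtain ⟨τ, hτ⟩ := hInv m
    exact hdef m τ hτ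
  · obtain ⟨τ, hτ⟩ := hInv n
    refine (Metric.diam_le_of_forall_dist_le (C := η / 3 + η / 3) (by linarith)
      fun b hb b' hb' => ?_).trans_lt (by linarith)
    have h1 := (hnear n τ hτ b hb).trans_le (min_le_left _ _)
    have h2 := (hnear n τ hτ b' hb').trans_le (min_le_left _ _)
    have := dist_triangle_right b b' ((firstReturn X T)^[n] x)
    linarith

/-- The reparametrized image of A at a visit time t₀ of the guide projects to a continuum in S i,
stable and unstable by shadowing in both directions. Once it is a single point, every y in A lies on
the orbit of x. Its time offset is the drift up to t₀ plus a projection time, hence below 2κ ≤ e. -/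
theorem isCwExpansive_of_stable_inter_unstable [CompactSpace M] {X : Flow ℝ M} {c : ℝ} (hc : 0 < c)
    (hper : ∀ x, ∀ t : ℝ, |t| ≤ c → X t x = x → t = 0) {ρ : ℝ} (hρ : 0 < ρ) {k : ℕ}
    {S T : Fin k → Set M} {g L : ℝ} (h : Returning X (⋃ i, S i) (⋃ i, T i) g L)
    (hreach : Reaches X S T) (hρg : 2 * ρ < g) {η : ℝ} (hη : 0 < η)
    (hST : ∀ A ∈ stableSet X ρ S T η ∩ unstableSet X ρ S T η, A.Subsingleton) :
    IsCwExpansive X := by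
  intro e he
  have hg := h.pos
  obtain ⟨κ₁, hκ₁, hit₁⟩ := exists_shadow_iterates hc hper hρ h hreach hρg hη
  obtain ⟨κ₂, hκ₂, hit₂⟩ := exists_shadow_iterates (X := X.reverse) hc
    (fun x t ht hx => neg_eq_zero.1 (hper x (-t) (by rwa [abs_neg]) hx)) hρ h.reverse hreach.reverse
    hρg hη
  set κ := min (min κ₁ κ₂) (min (e / 2) (g / 4))
  have hκ : 0 < κ := lt_min (lt_min hκ₁ hκ₂) (lt_min (by linarith) (by linarith))
  have hκe : κ ≤ e / 2 := (min_le_right _ _).trans (min_le_left _ _)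
  have hκg : κ ≤ g / 4 := (min_le_right _ _).trans (min_le_right _ _)
  obtain ⟨d₁, hd₁, hit₁⟩ := hit₁ κ hκ ((min_le_left _ _).trans (min_le_left _ _))
  obtain ⟨d₂, hd₂, hit₂⟩ := hit₂ κ hκ ((min_le_left _ _).trans (min_le_right _ _))
  obtain ⟨d₃, hd₃, hdrift⟩ := exists_drift hc hper L hκ
  obtain ⟨d₄, hd₄, hr⟩ := hreach κ hκ
  set d := min (min d₁ d₂) (min d₃ d₄)
  have hd₁' : d ≤ d₁ := (min_le_left _ _).trans (min_le_left _ _)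
  have hd₂' : d ≤ d₂ := (min_le_left _ _).trans (min_le_right _ _)
  have hd₃' : d ≤ d₃ := (min_le_right _ _).trans (min_le_left _ _)
  have hd₄' : d ≤ d₄ := (min_le_right _ _).trans (min_le_right _ _)
  refine ⟨d, lt_min (lt_min hd₁ hd₂) (lt_min hd₃ hd₄), fun A hAc hAconn α hα => ?_⟩
  obtain ⟨x, hx⟩ : ∃ x : M, x = α.guide := ⟨_, rfl⟩
  rw [← hx]
  have hclose : ∀ (y : A) t, dist (X (α.toHomeo y t) (y : M)) (X t x) < d := by
    intro y t
    have h1 : X t x ∈ α.image X t := ⟨α.guide, by simp only [α.guide_eq, hx]⟩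
    exact (Metric.dist_le_diam_of_mem Metric.isBounded_of_compactSpace
      (mem_range_self y) h1).trans_lt (hα t)
  obtain ⟨t₀, ht₀, hmem⟩ := h.visit x
  obtain ⟨i, hi⟩ := mem_iUnion.1 hmem
  have hex : ∀ y : A, ∃ s : ℝ, |s| < κ ∧ X s (X (α.toHomeo y t₀) (y : M)) ∈ S i := fun y =>
    hr i _ hi _ ((hclose y t₀).trans_le hd₄')
  choose s hs hsS using hex
  have hα_cont := α.continuous_apply t₀
  have hscont : Continuous s := h.sep.continuous h.closedK (ρ := κ) (by linarith)
    (f := fun y : A => X (α.toHomeo y t₀) (y : M)) (by fun_prop) (fun y => (hs y).le)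
    (fun y => mem_iUnion.2 ⟨i, hsS y⟩)
  set f : A → M := fun y => X (s y) (X (α.toHomeo y t₀) (y : M))
  have hf : Continuous f := by fun_prop
  have hfx : f α.guide = X t₀ x := by
    have h1 : s α.guide = 0 := by
      refine h.sep (X t₀ x) (h.subset hmem) _ ((hs _).trans_le (by linarith)) ?_
      have := hsS α.guide
      rw [α.guide_eq, ← hx] at this
      exact mem_iUnion.2 ⟨i, this⟩
    simp only [f, h1, Flow.map_zero_apply, α.guide_eq, hx]
  have : CompactSpace A := isCompact_iff_compactSpace.1 hAc
  have : ConnectedSpace A := isConnected_iff_connectedSpace.1 hAconn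
  have hBc : IsCompact (range f) := isCompact_range hf
  have hBconn : IsConnected (range f) := isConnected_range hf
  have hBS : range f ⊆ S i := by
    rintro _ ⟨y, rfl⟩
    exact hsS y
  have hB₁ : ∀ b ∈ range f, ∃ (y : A) (r : ℝ), |r - α.toHomeo y (t₀ + 0)| < κ ∧ X r (y : M) = b := by
    rintro _ ⟨y, rfl⟩
    exact ⟨y, s y + α.toHomeo y t₀, by simpa using hs y, Flow.map_add _ _ _ _⟩
  have hB₂ : ∀ b ∈ range f, ∃ (y : A) (r : ℝ), |r - -α.toHomeo y (t₀ - 0)| < κ ∧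
      X.reverse r (y : M) = b := by
    rintro b hb
    obtain ⟨y, r, hr, hb⟩ := hB₁ b hb
    refine ⟨y, -r, ?_, by simpa using hb⟩
    rw [← abs_neg]
    convert hr using 2
    rw [sub_zero, add_zero]
    ring
  have h₁ := hit₁ d hd₁' (fun y : A => (y : M)) (fun y t => α.toHomeo y (t₀ + t))
    (fun y => (α.toHomeo y).continuous.comp (by fun_prop)) (X t₀ x) hmem (fun y t _ => by
      rw [← Flow.map_add, add_comm t]
      exact hclose y (t₀ + t)) (range f) hB₁
  have h₂ := hit₂ d hd₂' (fun y : A => (y : M)) (fun y t => -α.toHomeo y (t₀ - t))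
    (fun y => ((α.toHomeo y).continuous.comp (by fun_prop)).neg) (X t₀ x) hmem (fun y t _ => by
      rw [Flow.reverse_apply, Flow.reverse_apply, ← Flow.map_add, neg_neg, neg_add_eq_sub]
      exact hclose y (t₀ - t)) (range f) hB₂
  have hsub := hST (range f) ⟨⟨hBc, hBconn, i, hBS, X t₀ x, ⟨⟨_, hfx⟩, hi⟩, fun n hn => ?_⟩,
    hBc, hBconn, i, hBS, X t₀ x, ⟨⟨_, hfx⟩, hi⟩, fun n hn => ?_⟩
  · intro y hy
    have h3 : f ⟨y, hy⟩ = X t₀ x := (hsub ⟨_, rfl⟩ ⟨_, rfl⟩).trans hfx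
    have h4 := hdrift x y (α.toHomeo ⟨y, hy⟩) (α.toHomeo ⟨y, hy⟩).continuous (α.map_zero _)
      (fun t _ => (hclose ⟨y, hy⟩ t).trans_le hd₃') t₀ ht₀
    have h5 := hs ⟨y, hy⟩
    refine ⟨t₀ - (s ⟨y, hy⟩ + α.toHomeo ⟨y, hy⟩ t₀), ?_, x, rfl, ?_⟩
    · rw [abs_lt] at h4 h5
      constructor <;> linarith
    · rw [sub_eq_neg_add, Flow.map_add, ← h3]
      simp only [f, ← Flow.map_add]
      simp
  · cases n with
    | ofNat n => exact h₁ n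
    | negSucc n => exact absurd hn (by simp)
  · cases n with
    -- Among the indices n ≤ 0 only 0 has this form; the others are iterates of the reversed flow.
    | ofNat n =>
      have : n = 0 := by
        have : (n : ℤ) ≤ 0 := hn
        omega
      rw [this]
      exact h₁ 0
    | negSucc n => exact h₂ (n + 1)

/-! ### Local cross-sections -/

/-- Averaging the distance to `x` along the flow gives a function that increases along the orbits
near `x`. -/
theorem exists_increasing_along_flow [CompactSpace M] {X : Flow ℝ M} {c : ℝ}
    (hc : 0 < c) (hper : ∀ x, ∀ t : ℝ, |t| ≤ c → X t x = x → t = 0) :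
    ∃ r > 0, ∀ x, ∃ f : M → ℝ, Continuous f ∧ ∀ y, dist y x ≤ r → ∀ t₁ t₂, -r ≤ t₁ → t₁ < t₂ →
      t₂ ≤ r → f (X t₁ y) < f (X t₂ y) := by
  obtain ⟨m, hm, hmin⟩ := (isCompact_univ : IsCompact (univ : Set M)).exists_forall_le' (a := 0)
    (f := fun x => dist (X c x) x) (by fun_prop) (fun x _ => dist_pos.2 fun h =>
      hc.ne' (hper x c (abs_of_pos hc).le h))
  obtain ⟨d, hd, hu⟩ := uniform_flow X (c + 1) (half_pos hm)
  refine ⟨min (d / 2) 1, lt_min (half_pos hd) one_pos, fun x => ?_⟩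
  have hint : ∀ y : M, Continuous fun s => dist (X s y) x := fun y => by fun_prop
  refine ⟨fun y => ∫ s in (0 : ℝ)..c, dist (X s y) x,
    intervalIntegral.continuous_parametric_intervalIntegral_of_continuous'
      (f := fun y s => dist (X s y) x) (by fun_prop) _ _, fun y hy t₁ t₂ h₁ h₁₂ h₂ => ?_⟩
  have hshift : ∀ t, ∫ s in (0 : ℝ)..c, dist (X s (X t y)) x =
      ∫ s in t..t + c, dist (X s y) x := fun t => by
    have := intervalIntegral.integral_comp_add_right (a := 0) (b := c)
      (fun s => dist (X s y) x) t
    simp only [Flow.map_add] at this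
    rw [this, zero_add, add_comm]
  -- The increment of f from t₁ to t₂. The integrand is positive because near x the point `X s y` is
  -- within m/2 of x, while `X (s + c) y` is within m/2 of `X c x`, itself at least m away from x.
  have hpos : 0 < ∫ s in t₁..t₂, (dist (X (s + c) y) x - dist (X s y) x) := by
    refine intervalIntegral.intervalIntegral_pos_of_pos_on
      (Continuous.intervalIntegrable (by fun_prop) _ _) (fun s hs => ?_) h₁₂
    have hs1 : |s| ≤ min (d / 2) 1 := abs_le.2 ⟨by linarith [hs.1], by linarith [hs.2]⟩
    rw [le_min_iff] at hs1 hy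
    have hsc : |s + c| ≤ c + 1 := by
      have := abs_add_le s c
      rw [abs_of_pos hc] at this
      linarith
    have h1 := hu (s + c) c hsc (by rw [abs_of_pos hc]; linarith)
      (by rw [add_sub_cancel_right]; linarith) y x (by linarith)
    have h2 := hu s 0 (by linarith) (by rw [abs_zero]; linarith) (by rw [sub_zero]; linarith) y x
      (by linarith)
    rw [Flow.map_zero_apply] at h2
    have h3 := hmin x (mem_univ x)
    have h4 := dist_triangle_left (X c x) x (X (s + c) y)
    linarith
  simp only [hshift]
  rw [← sub_pos, intervalIntegral.integral_interval_sub_interval_comm'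
    ((hint y).intervalIntegrable _ _) ((hint y).intervalIntegrable _ _)
    ((hint y).intervalIntegrable _ _)]
  rw [intervalIntegral.integral_sub (Continuous.intervalIntegrable (by fun_prop) _ _)
    ((hint y).intervalIntegrable _ _), intervalIntegral.integral_comp_add_right
    (fun s => dist (X s y) x)] at hpos
  exact hpos

/-- Points close to `z` reach `S` along the flow in short time. -/
def TransverseAt (X : Flow ℝ M) (S : Set M) (z : M) : Prop :=
  ∀ ρ > 0, ∀ᶠ w in 𝓝 z, ∃ t : ℝ, |t| < ρ ∧ X t w ∈ S

theorem TransverseAt.inter {X : Flow ℝ M} {S V : Set M} {z : M} (h : TransverseAt X S z)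
    (hV : V ∈ 𝓝 z) : TransverseAt X (S ∩ V) z := by
  intro ρ hρ
  have hcont : Continuous fun q : ℝ × M => X q.1 q.2 := by fun_prop
  have h1 : ∀ᶠ q : ℝ × M in 𝓝 (0, z), X q.1 q.2 ∈ V :=
    hcont.continuousAt.eventually_mem (by simpa using hV)
  obtain ⟨r, hr, hball⟩ := Metric.eventually_nhds_iff.1 h1
  filter_upwards [h (min ρ r) (lt_min hρ hr), Metric.ball_mem_nhds z hr] with w hw hwz
  obtain ⟨t, ht, htS⟩ := hw
  rw [lt_min_iff] at ht
  refine ⟨t, ht.1, htS, hball (y := (t, w)) ?_⟩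
  rw [Prod.dist_eq, max_lt_iff]
  exact ⟨by simpa [Real.dist_eq] using ht.2, hwz⟩

theorem TransverseAt.image {X : Flow ℝ M} {S : Set M} {z : M} (h : TransverseAt X S z) (u : ℝ) :
    TransverseAt X (X u '' S) (X u z) := by
  intro ρ hρ
  have hcont : Continuous (X (-u)) := X.continuous_toFun (-u)
  have hz : X (-u) (X u z) = z := by simp [← Flow.map_add]
  have := hcont.tendsto (X u z)
  rw [hz] at this
  filter_upwards [this.eventually (h ρ hρ)] with w hw
  obtain ⟨t, ht, htS⟩ := hw
  refine ⟨t, ht, _, htS, ?_⟩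
  rw [← Flow.map_add, ← Flow.map_add]
  congr 1
  ring

/-- Local cross-sections through every point, with a uniform separation time. -/
theorem exists_local_section [CompactSpace M] {X : Flow ℝ M} {c : ℝ}
    (hc : 0 < c) (hper : ∀ x, ∀ t : ℝ, |t| ≤ c → X t x = x → t = 0) :
    ∃ g > 0, ∀ x, ∃ S T : Set M, IsClosed S ∧ IsClosed T ∧ T ⊆ S ∧ Separated X S g ∧
      (∀ z ∈ T, TransverseAt X S z) ∧ TransverseAt X T x := by
  obtain ⟨r, hr, hf⟩ := exists_increasing_along_flow hc hper
  refine ⟨r, hr, fun x => ?_⟩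
  obtain ⟨f, hfc, hmono⟩ := hf x
  have htrans : ∀ z, dist z x < r → f z = f x →
      TransverseAt X (Metric.closedBall x r ∩ {y | f y = f x}) z := by
    intro z hz hfz ρ hρ
    have h1 : ∀ᶠ q : ℝ × M in 𝓝 (0, z), dist (X q.1 q.2) x < r := by
      refine ContinuousAt.eventually_lt (Continuous.continuousAt (by fun_prop))
        continuousAt_const ?_
      simpa using hz
    obtain ⟨r', hr', hball⟩ := Metric.eventually_nhds_iff.1 h1
    obtain ⟨τ, hτ, hτ'⟩ : ∃ τ, 0 < τ ∧ τ < min ρ (min r r') :=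
      exists_between (lt_min hρ (lt_min hr hr'))
    simp only [lt_min_iff] at hτ'
    -- Strict inequalities just before and just after z persist for nearby w, whose orbits then
    -- cross the level by the intermediate value theorem.
    have hlow : f (X (-τ) z) < f x := by
      have := hmono z hz.le (-τ) 0 (by linarith) (by linarith) hr.le
      rwa [Flow.map_zero_apply, hfz] at this
    have hup : f x < f (X τ z) := by
      have := hmono z hz.le 0 τ (by linarith) hτ (by linarith)
      rwa [Flow.map_zero_apply, hfz] at this
    have h2 : ∀ᶠ w in 𝓝 z, f (X (-τ) w) < f x :=
      ContinuousAt.eventually_lt (Continuous.continuousAt (by fun_prop)) continuousAt_const hlow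
    have h3 : ∀ᶠ w in 𝓝 z, f x < f (X τ w) :=
      ContinuousAt.eventually_lt continuousAt_const (Continuous.continuousAt (by fun_prop)) hup
    filter_upwards [h2, h3, Metric.ball_mem_nhds z hr'] with w hw2 hw3 hwz
    obtain ⟨t, ht, htf⟩ := intermediate_value_Icc (a := -τ) (b := τ) (by linarith)
      (f := fun t => f (X t w)) (by fun_prop) (show f x ∈ _ from ⟨hw2.le, hw3.le⟩)
    have htτ : |t| ≤ τ := abs_le.2 ht
    refine ⟨t, by linarith, ?_, htf⟩
    refine (hball (y := (t, w)) ?_).le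
    rw [Prod.dist_eq, max_lt_iff]
    exact ⟨by simpa [Real.dist_eq] using htτ.trans_lt hτ'.2.2, hwz⟩
  have hlevel : IsClosed {y | f y = f x} := isClosed_eq hfc continuous_const
  -- T is the part of the level set in the half ball, away from the boundary sphere of S, where
  -- transversality could fail.
  refine ⟨Metric.closedBall x r ∩ {y | f y = f x},
    Metric.closedBall x r ∩ {y | f y = f x} ∩ Metric.closedBall x (r / 2),
    Metric.isClosed_closedBall.inter hlevel,
    (Metric.isClosed_closedBall.inter hlevel).inter Metric.isClosed_closedBall,
    inter_subset_left, ?_, ?_, ?_⟩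
  · rintro y ⟨hy, hfy⟩ t ht ⟨-, hfy'⟩
    have heq : f (X t y) = f (X 0 y) := by
      rw [Flow.map_zero_apply]
      exact Eq.trans hfy' (Eq.symm hfy)
    have ht' := abs_lt.1 ht
    rcases lt_trichotomy t 0 with h | h | h
    · exact absurd heq (hmono y hy t 0 ht'.1.le h hr.le).ne
    · exact h
    · exact absurd heq (hmono y hy 0 t (by linarith) h ht'.2.le).ne'
  · rintro z ⟨⟨-, hz⟩, hz'⟩
    exact htrans z (lt_of_le_of_lt hz' (half_lt_self hr)) hz
  · exact (htrans x (by simpa using hr) rfl).inter (Metric.closedBall_mem_nhds x (half_pos hr))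

/-! ### Disjoint families of cross-sections -/

/-- Serves to shift the pieces of one section by pairwise distinct times, each from its own
interval. -/
theorem exists_injOn_mem_of_infinite {α β : Type*} [Nonempty β] (t : Finset α) {I : α → Set β}
    (hI : ∀ a ∈ t, (I a).Infinite) : ∃ v : α → β, (∀ a ∈ t, v a ∈ I a) ∧ InjOn v t := by
  classical
  induction t using Finset.induction_on with
  | empty => exact ⟨fun _ => Classical.arbitrary β, by simp, by simp⟩
  | insert a t ha ih =>
    obtain ⟨v, hv, hinj⟩ := ih fun b hb => hI b (Finset.mem_insert_of_mem hb)
    obtain ⟨b, hb, hbt⟩ := (hI a (Finset.mem_insert_self a t)).exists_notMem_finset (t.image v)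
    have hne : ∀ x ∈ t, x ≠ a := fun x hx h => ha (h ▸ hx)
    refine ⟨Function.update v a b, fun x hx => ?_, ?_⟩
    · rcases Finset.mem_insert.1 hx with rfl | hx
      · rwa [Function.update_self]
      · rw [Function.update_of_ne (hne x hx)]
        exact hv x hx
    · rw [Finset.coe_insert, injOn_insert (by simpa using ha)]
      have heq : EqOn (Function.update v a b) v t := fun x hx =>
        Function.update_of_ne (hne x hx) _ _
      refine ⟨hinj.congr heq.symm, ?_⟩
      rw [heq.image_eq, Function.update_self]
      simpa using hbt

/-- A finite family of disjoint cross-sections, each with a closed part at which it is transverse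
to the flow. -/
structure IsBoxFamily (X : Flow ℝ M) (g δ : ℝ) (F : Set (Set M × Set M)) : Prop where
  finite : F.Finite
  closedS : ∀ p ∈ F, IsClosed p.1
  closedT : ∀ p ∈ F, IsClosed p.2
  subset : ∀ p ∈ F, p.2 ⊆ p.1
  diam : ∀ p ∈ F, Metric.diam p.1 ≤ δ
  sep : ∀ p ∈ F, Separated X p.1 g
  transverse : ∀ p ∈ F, ∀ z ∈ p.2, TransverseAt X p.1 z
  disjoint : ∀ p ∈ F, ∀ q ∈ F, p ≠ q → Disjoint p.1 q.1

/-- Pieces of a cross-section can be moved along the flow off a given family of boxes. -/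
theorem IsBoxFamily.extend [CompactSpace M] {X : Flow ℝ M} {g δ κ : ℝ} {F : Set (Set M × Set M)}
    (hF : IsBoxFamily X g δ F) (hδ : 0 < δ) (hκ : 0 < κ) (hκg : 2 * κ ≤ g) {S T : Set M}
    (hS : IsClosed S) (hT : IsClosed T) (hTS : T ⊆ S) (hsep : Separated X S g)
    (htrans : ∀ z ∈ T, TransverseAt X S z) :
    ∃ F', F ⊆ F' ∧ IsBoxFamily X g δ F' ∧ ∀ y ∈ T, ∃ u : ℝ, |u| < κ ∧ ∃ p ∈ F', X u y ∈ p.2 := by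
  classical
  set K := ⋃ p ∈ F, p.1
  have hK : IsClosed K := hF.finite.isClosed_biUnion hF.closedS
  have hfree : ∀ y, ∃ u ∈ Ioo (-κ) κ, X u y ∉ K := by
    intro y
    -- Two times in the interval differ by less than 2κ ≤ g, so each of the finitely many boxes is
    -- met at most once.
    have hbad : {u ∈ Ioo (-κ) κ | X u y ∈ K}.Finite := by
      refine (hF.finite.biUnion (t := fun p => {u ∈ Ioo (-κ) κ | X u y ∈ p.1})
        fun p hp => Set.Subsingleton.finite ?_).subset ?_
      · rintro u ⟨hu, huS⟩ v ⟨hv, hvS⟩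
        refine (hF.sep p hp).eq huS hvS ?_
        rw [abs_lt]
        constructor <;> linarith [hu.1, hu.2, hv.1, hv.2]
      · rintro u ⟨hu, huK⟩
        obtain ⟨p, hp, hup⟩ := mem_iUnion₂.1 huK
        exact mem_iUnion₂.2 ⟨p, hp, hu, hup⟩
    obtain ⟨u, hu, hu'⟩ := (Ioo_infinite (show -κ < κ by linarith)).exists_notMem_finset
      hbad.toFinset
    refine ⟨u, hu, fun hK => hu' ?_⟩
    rw [Set.Finite.mem_toFinset]
    exact ⟨hu, hK⟩
  choose u hu huK using hfree
  have hloc : ∀ y, ∃ r > 0, ∀ v w, |v - u y| < r → dist w y ≤ r →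
      X v w ∈ Metric.ball (X (u y) y) (δ / 2) ∩ Kᶜ := by
    intro y
    have hcont : Continuous fun q : ℝ × M => X q.1 q.2 := by fun_prop
    have h1 : ∀ᶠ q : ℝ × M in 𝓝 (u y, y), X q.1 q.2 ∈ Metric.ball (X (u y) y) (δ / 2) ∩ Kᶜ :=
      hcont.continuousAt.eventually_mem
        ((Metric.isOpen_ball.inter hK.isOpen_compl).mem_nhds
          ⟨Metric.mem_ball_self (half_pos hδ), huK y⟩)
    obtain ⟨r, hr, hball⟩ := Metric.eventually_nhds_iff.1 h1
    refine ⟨r / 2, half_pos hr, fun v w hv hw => hball (y := (v, w)) ?_⟩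
    rw [Prod.dist_eq, max_lt_iff, Real.dist_eq]
    exact ⟨by linarith, by simp only; linarith⟩
  choose r hr hrball using hloc
  obtain ⟨t, -, htcov⟩ := hT.isCompact.elim_nhds_subcover (fun y => Metric.ball y (r y / 2))
    fun y _ => Metric.ball_mem_nhds y (half_pos (hr y))
  obtain ⟨v, hv, hinj⟩ := exists_injOn_mem_of_infinite t
    (I := fun y => Ioo (max (-κ) (u y - r y)) (min κ (u y + r y))) fun y _ => by
      refine Ioo_infinite ?_
      have h1 := (hu y).1
      have h2 := (hu y).2
      have h3 := hr y
      rw [max_lt_iff, lt_min_iff, lt_min_iff]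
      exact ⟨⟨by linarith, by linarith⟩, by linarith, by linarith⟩
  have hvκ : ∀ y ∈ t, |v y| < κ := fun y hy => by
    obtain ⟨h1, h2⟩ := hv y hy
    rw [max_lt_iff] at h1
    rw [lt_min_iff] at h2
    exact abs_lt.2 ⟨h1.1, h2.1⟩
  have hvr : ∀ y ∈ t, |v y - u y| < r y := fun y hy => by
    obtain ⟨h1, h2⟩ := hv y hy
    rw [max_lt_iff] at h1
    rw [lt_min_iff] at h2
    exact abs_lt.2 ⟨by linarith [h1.2], by linarith [h2.2]⟩
  -- The piece of T uses half the radius of the piece of S, so the latter stays transverse at all of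
  -- the former.
  set N : M → Set M × Set M := fun y => (X (v y) '' (S ∩ Metric.closedBall y (r y)),
    X (v y) '' (T ∩ Metric.closedBall y (r y / 2)))
  have hclosed : ∀ (s : ℝ) (A : Set M), IsClosed A → IsClosed (X s '' A) := fun s A hA =>
    (hA.isCompact.image (X.continuous_toFun s)).isClosed
  have hNsub : ∀ y ∈ t, (N y).1 ⊆ Metric.ball (X (u y) y) (δ / 2) ∩ Kᶜ := by
    rintro y hy _ ⟨w, ⟨-, hw⟩, rfl⟩
    exact hrball y _ _ (hvr y hy) hw
  have hNF : ∀ y ∈ t, ∀ p ∈ F, Disjoint (N y).1 p.1 := fun y hy p hp =>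
    disjoint_left.2 fun w hw hwp => (hNsub y hy hw).2 (mem_iUnion₂.2 ⟨p, hp, hwp⟩)
  refine ⟨F ∪ N '' t, subset_union_left, ⟨hF.finite.union (t.finite_toSet.image N), ?_, ?_, ?_,
    ?_, ?_, ?_, ?_⟩, fun y hy => ?_⟩
  · rintro p (hp | ⟨y, hy, rfl⟩)
    · exact hF.closedS p hp
    · exact hclosed _ _ (hS.inter Metric.isClosed_closedBall)
  · rintro p (hp | ⟨y, hy, rfl⟩)
    · exact hF.closedT p hp
    · exact hclosed _ _ (hT.inter Metric.isClosed_closedBall)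
  · rintro p (hp | ⟨y, hy, rfl⟩)
    · exact hF.subset p hp
    · exact image_mono (inter_subset_inter hTS
        (Metric.closedBall_subset_closedBall (by linarith [hr y])))
  · rintro p (hp | ⟨y, hy, rfl⟩)
    · exact hF.diam p hp
    · refine (Metric.diam_mono ((hNsub y hy).trans inter_subset_left) Metric.isBounded_ball).trans
        ((Metric.diam_ball (half_pos hδ).le).trans (by linarith))
  · rintro p (hp | ⟨y, hy, rfl⟩)
    · exact hF.sep p hp
    · rintro _ ⟨w, ⟨hw, -⟩, rfl⟩ s hs ⟨w', ⟨hw', -⟩, hww⟩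
      refine hsep w hw s hs ?_
      have : X s w = w' := by
        have h1 := congrArg (X (-v y)) hww
        simp only [← Flow.map_add] at h1
        simpa using h1.symm
      rwa [this]
  · rintro p (hp | ⟨y, hy, rfl⟩)
    · exact hF.transverse p hp
    · rintro _ ⟨z, ⟨hz, hzy⟩, rfl⟩
      refine ((htrans z hz).inter ?_).image _
      exact Metric.closedBall_mem_nhds_of_mem (lt_of_le_of_lt hzy (half_lt_self (hr y)))
  · rintro p (hp | ⟨y, hy, rfl⟩) q (hq | ⟨z, hz, rfl⟩) hpq
    · exact hF.disjoint p hp q hq hpq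
    · exact (hNF z hz p hp).symm
    · exact hNF y hy q hq
    · refine disjoint_left.2 ?_
      rintro _ ⟨w, ⟨hw, -⟩, rfl⟩ ⟨w', ⟨hw', -⟩, hww⟩
      -- A common point of two shifted pieces gives two points of S joined by an orbit arc shorter
      -- than 2κ ≤ g; separation forces equal shifts.
      have hvv : v y = v z := by
        have h1 : X (v y - v z) w = w' := by
          have h1 := congrArg (X (-v z)) hww
          simp only [← Flow.map_add, neg_add_cancel, Flow.map_zero_apply] at h1
          rw [h1, sub_eq_neg_add]
        refine sub_eq_zero.1 (hsep w hw (v y - v z) ?_ (by rwa [h1]))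
        have h2 := abs_lt.1 (hvκ y hy)
        have h3 := abs_lt.1 (hvκ z hz)
        rw [abs_lt]
        constructor <;> linarith
      exact hpq (by rw [hinj hy hz hvv])
  · obtain ⟨z, hz, hyz⟩ := mem_iUnion₂.1 (htcov hy)
    exact ⟨v z, hvκ z hz, N z, Or.inr ⟨z, hz, rfl⟩, y, ⟨hy, Metric.ball_subset_closedBall hyz⟩, rfl⟩

theorem isBoxFamily_empty (X : Flow ℝ M) (g δ : ℝ) : IsBoxFamily X g δ ∅ := by
  constructor <;> simp

/-- Every compact space with a flow without short periods has a finite family of disjoint small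
cross-sections visited by all short orbit arcs. -/
theorem exists_boxFamily [CompactSpace M] {X : Flow ℝ M} {c : ℝ}
    (hc : 0 < c) (hper : ∀ x, ∀ t : ℝ, |t| ≤ c → X t x = x → t = 0) {δ : ℝ} (hδ : 0 < δ) :
    ∃ g > 0, ∃ F, IsBoxFamily X g δ F ∧ ∀ x, ∃ u : ℝ, |u| ≤ g / 2 ∧ ∃ p ∈ F, X u x ∈ p.2 := by
  obtain ⟨g, hg, hloc⟩ := exists_local_section hc hper
  refine ⟨g, hg, ?_⟩
  have key : ∀ F, IsBoxFamily X g δ F → ∃ F', F ⊆ F' ∧ IsBoxFamily X g δ F' ∧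
      ∀ x ∈ (univ : Set M), ∃ u : ℝ, |u| ≤ g / 2 ∧ ∃ p ∈ F', X u x ∈ p.2 := by
    -- The statement quantifies over all initial families, so that the family for one set can be
    -- extended to serve a second one.
    refine IsCompact.induction_on (isCompact_univ (X := M)) (p := fun C => ∀ F, IsBoxFamily X g δ F →
      ∃ F', F ⊆ F' ∧ IsBoxFamily X g δ F' ∧
        ∀ x ∈ C, ∃ u : ℝ, |u| ≤ g / 2 ∧ ∃ p ∈ F', X u x ∈ p.2) ?_ ?_ ?_ ?_
    · exact fun F hF => ⟨F, subset_rfl, hF, fun x hx => absurd hx (notMem_empty x)⟩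
    · intro C D hCD hD F hF
      obtain ⟨F', h1, h2, h3⟩ := hD F hF
      exact ⟨F', h1, h2, fun x hx => h3 x (hCD hx)⟩
    · intro C D hC hD F hF
      obtain ⟨F₁, h1, h2, h3⟩ := hC F hF
      obtain ⟨F₂, h4, h5, h6⟩ := hD F₁ h2
      refine ⟨F₂, h1.trans h4, h5, fun x hx => ?_⟩
      rcases hx with hx | hx
      · obtain ⟨u, hu, p, hp, hup⟩ := h3 x hx
        exact ⟨u, hu, p, h4 hp, hup⟩
      · exact h6 x hx
    · intro x _
      obtain ⟨S, T, hS, hT, hTS, hsep, htrans, hx⟩ := hloc x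
      -- Time g/4 to reach T, and at most g/4 more to reach its shifted piece.
      refine ⟨_, mem_nhdsWithin_of_mem_nhds (hx (g / 4) (by linarith)), fun F hF => ?_⟩
      obtain ⟨F', h1, h2, h3⟩ := hF.extend hδ (κ := g / 4) (by linarith) (by linarith) hS hT hTS hsep
        htrans
      refine ⟨F', h1, h2, ?_⟩
      rintro w ⟨t, ht, htT⟩
      obtain ⟨u, hu, p, hp, hup⟩ := h3 _ htT
      rw [← Flow.map_add] at hup
      exact ⟨u + t, by linarith [abs_add_le u t], p, hp, hup⟩
  obtain ⟨F, -, hF, hcov⟩ := key ∅ (isBoxFamily_empty X g δ)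
  exact ⟨F, hF, fun x => hcov x (mem_univ x)⟩

/-! ### Existence of adequate pairs and admissible constants -/

theorem mem_flowImage_of_map_mem {X : Flow ℝ M} {I : Set ℝ} {A : Set M} {x : M} {t : ℝ}
    (ht : -t ∈ I) (h : X t x ∈ A) : x ∈ flowImage X I A :=
  ⟨-t, ht, _, h, by simp [← Flow.map_add]⟩

/-- Finitely many disjoint closed cross-sections have a separated union. -/
theorem exists_separated_iUnion [CompactSpace M] {X : Flow ℝ M} {k : ℕ} {S : Fin k → Set M} {g : ℝ}
    (hg : 0 < g) (hS : ∀ i, IsClosed (S i)) (hsep : ∀ i, Separated X (S i) g)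
    (hdisj : ∀ i j, i ≠ j → Disjoint (S i) (S j)) : ∃ d > 0, Separated X (⋃ i, S i) d := by
  have key : ∀ i j, ∀ᶠ t : ℝ in 𝓝 0, ∀ x ∈ S i, t ≠ 0 → X t x ∉ S j := by
    intro i j
    rcases eq_or_ne i j with rfl | hij
    · filter_upwards [Metric.ball_mem_nhds (0 : ℝ) hg] with t ht x hx h0 hmem
      exact h0 (hsep i x hx t (by simpa [Real.dist_eq] using ht) hmem)
    · refine (hS i).isCompact.eventually_forall_of_forall_eventually
        (P := fun t x => t ≠ 0 → X t x ∉ S j) fun x hx => ?_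
      have hcont : Continuous fun q : ℝ × M => X q.1 q.2 := by fun_prop
      filter_upwards [hcont.continuousAt.eventually_mem ((hS j).isOpen_compl.mem_nhds
        (show X (0 : ℝ) x ∈ (S j)ᶜ by
          rw [Flow.map_zero_apply]
          exact disjoint_left.1 (hdisj i j hij) hx))] with q hq _
      exact hq
  obtain ⟨d, hd, hball⟩ := Metric.eventually_nhds_iff.1
    (eventually_all.2 fun i => eventually_all.2 fun j => key i j)
  refine ⟨d, hd, fun x hx t ht hmem => ?_⟩
  by_contra h0
  obtain ⟨i, hi⟩ := mem_iUnion.1 hx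
  obtain ⟨j, hj⟩ := mem_iUnion.1 hmem
  exact hball (y := t) (by simpa [Real.dist_eq] using ht) i j x hi h0 hj

/-- An actual return at time t bounds the set defining the gap; for an unbounded set `sSup` would be
0. -/
theorem Separated.le_gap {X : Flow ℝ M} {k : ℕ} {S : Fin k → Set M} {d : ℝ} (hd : 0 < d)
    (h : Separated X (⋃ i, S i) d) {x : M} (hx : x ∈ ⋃ i, S i) {t : ℝ} (ht : 0 < t)
    (hxt : X t x ∈ ⋃ i, S i) : d ≤ gap X S := by
  refine le_csSup ⟨t, ?_⟩ ⟨hd, ?_⟩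
  · rintro d' ⟨-, hd'⟩
    by_contra hlt
    exact eq_empty_iff_forall_notMem.1 (hd' x hx) _
      ⟨⟨t, ⟨ht, not_le.1 hlt⟩, x, rfl, rfl⟩, hxt⟩
  · rintro y hy
    refine eq_empty_iff_forall_notMem.2 ?_
    rintro _ ⟨⟨s, hs, _, rfl, rfl⟩, hmem⟩
    have := h _ hy s (by rw [abs_of_pos hs.1]; exact hs.2) hmem
    linarith [hs.1]

theorem reaches_of_transverse [CompactSpace M] {X : Flow ℝ M} {k : ℕ} {S T : Fin k → Set M}
    (hT : ∀ i, IsClosed (T i)) (h : ∀ i, ∀ z ∈ T i, TransverseAt X (S i) z) : Reaches X S T := by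
  intro κ hκ
  have key : ∀ i, ∀ᶠ r : ℝ in 𝓝[>] 0, ∀ x ∈ T i, ∀ w, dist w x < r →
      ∃ s : ℝ, |s| < κ ∧ X s w ∈ S i := by
    intro i
    obtain ⟨r, hr, hsub⟩ := (hT i).isCompact.exists_thickening_subset_open
      (isOpen_interior (s := {w | ∃ s : ℝ, |s| < κ ∧ X s w ∈ S i}))
      fun z hz => mem_interior_iff_mem_nhds.2 (h i z hz κ hκ)
    filter_upwards [Ioo_mem_nhdsGT hr] with r' hr' x hx w hw
    have hmem := interior_subset (hsub (Metric.mem_thickening_iff.2 ⟨x, hx, hw.trans hr'.2⟩))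
    exact hmem
  obtain ⟨r, hr, hr0⟩ := ((eventually_all.2 key).and self_mem_nhdsWithin).exists
  exact ⟨r, hr0, hr⟩

theorem exists_adequatePair [CompactSpace M] [Nonempty M] {X : Flow ℝ M} {c : ℝ}
    (hc : 0 < c) (hper : ∀ x, ∀ t : ℝ, |t| ≤ c → X t x = x → t = 0) {δ : ℝ} (hδ : 0 < δ) :
    ∃ (ε : ℝ) (k : ℕ) (S T : Fin k → Set M), IsAdequatePair X ε δ S T ∧ 0 < gap X S ∧
      Reaches X S T := by
  obtain ⟨g, hg, F, hF, hcov⟩ := exists_boxFamily hc hper hδ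
  have := hF.finite.to_subtype
  obtain ⟨k, ⟨e⟩⟩ := Finite.exists_equiv_fin F
  set S : Fin k → Set M := fun i => (e.symm i).1.1
  set T : Fin k → Set M := fun i => (e.symm i).1.2
  have hmem : ∀ i, (e.symm i).1 ∈ F := fun i => (e.symm i).2
  have hTS : ∀ i, T i ⊆ S i := fun i => hF.subset _ (hmem i)
  have hvisit : ∀ x, ∃ u ∈ Icc 0 g, ∃ i, X u x ∈ T i := by
    intro x
    obtain ⟨u, hu, p, hp, hup⟩ := hcov (X (g / 2) x)
    rw [← Flow.map_add] at hup
    have := abs_le.1 hu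
    exact ⟨u + g / 2, ⟨by linarith, by linarith⟩, e ⟨p, hp⟩, by simpa [T] using hup⟩
  have hvisit' : ∀ x, ∃ u ∈ Icc (-g) 0, ∃ i, X u x ∈ T i := by
    intro x
    obtain ⟨u, hu, i, hi⟩ := hvisit (X (-g) x)
    rw [← Flow.map_add] at hi
    exact ⟨u + -g, ⟨by linarith [hu.1], by linarith [hu.2]⟩, i, hi⟩
  have hcross : ∀ A : Set M, IsClosed A → Separated X A g → IsCrossSection X g A := by
    refine fun A hA hsep => ⟨hA, fun x hx => subset_antisymm ?_ ?_⟩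
    · rintro _ ⟨hz, t, ht, _, rfl, rfl⟩
      rw [hsep _ hx t (abs_lt.2 ht) hz, Flow.map_zero_apply]
      rfl
    · rintro _ rfl
      exact ⟨hx, 0, ⟨by linarith, hg⟩, _, rfl, Flow.map_zero_apply _ _⟩
  have hsepS : ∀ i, Separated X (S i) g := fun i => hF.sep _ (hmem i)
  obtain ⟨d, hd, hsep⟩ := exists_separated_iUnion hg (fun i => hF.closedS _ (hmem i)) hsepS
    (fun i j hij => hF.disjoint _ (hmem i) _ (hmem j) fun h =>
      hij (e.symm.injective (Subtype.ext h)))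
  have htrans : ∀ i, ∀ z ∈ T i, TransverseAt X (S i) z := fun i => hF.transverse _ (hmem i)
  refine ⟨g, k, S, T, ⟨hg, fun i => hcross _ (hF.closedS _ (hmem i)) (hsepS i),
    fun i => hcross _ (hF.closedT _ (hmem i)) fun x hx t ht hxt =>
      hsepS i x (hTS i hx) t ht (hTS i hxt),
    fun i => hF.diam _ (hmem i), fun i => (Metric.diam_mono (hTS i)
      Metric.isBounded_of_compactSpace).trans (hF.diam _ (hmem i)), fun i z hz => ⟨?_, hTS i hz⟩,
    ?_, ?_, ?_, ?_⟩, ?_, reaches_of_transverse (fun i => hF.closedT _ (hmem i)) htrans⟩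
  · refine mem_interior_iff_mem_nhds.2 ?_
    filter_upwards [htrans i z hz g hg] with w hw
    obtain ⟨t, ht, htS⟩ := hw
    have := abs_lt.1 ht
    exact mem_flowImage_of_map_mem ⟨by linarith, by linarith⟩ htS
  · refine eq_univ_of_forall fun x => ?_
    obtain ⟨u, hu, i, hi⟩ := hvisit' x
    exact mem_iUnion.2 ⟨i, mem_flowImage_of_map_mem ⟨by linarith [hu.2], by linarith [hu.1]⟩ hi⟩
  · refine eq_univ_of_forall fun x => ?_
    obtain ⟨u, hu, i, hi⟩ := hvisit x
    exact mem_iUnion.2 ⟨i, mem_flowImage_of_map_mem ⟨by linarith [hu.2], by linarith [hu.1]⟩ hi⟩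
  · refine eq_univ_of_forall fun x => ?_
    obtain ⟨u, hu, i, hi⟩ := hvisit' x
    exact mem_iUnion.2 ⟨i, mem_flowImage_of_map_mem ⟨by linarith [hu.2], by linarith [hu.1]⟩
      (hTS i hi)⟩
  · refine eq_univ_of_forall fun x => ?_
    obtain ⟨u, hu, i, hi⟩ := hvisit x
    exact mem_iUnion.2 ⟨i, mem_flowImage_of_map_mem ⟨by linarith [hu.2], by linarith [hu.1]⟩
      (hTS i hi)⟩
  -- A visit sought after a further time g > 0 provides the return needed to bound the gap from
  -- below.
  · obtain ⟨u, -, i, hi⟩ := hvisit (Classical.arbitrary M)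
    obtain ⟨u', hu', i', hi'⟩ := hvisit (X g (X u (Classical.arbitrary M)))
    rw [← Flow.map_add] at hi'
    exact hd.trans_le (hsep.le_gap hd (mem_iUnion.2 ⟨i, hTS i hi⟩) (t := u' + g)
      (by linarith [hu'.1]) (mem_iUnion.2 ⟨i', hTS i' hi'⟩))

/-- Uniform continuity for |t| ≤ 3δ keeps `X t y` close to T j, from where S j is reached in time
below ρ. -/
theorem Reaches.exists_admissible [CompactSpace M] {X : Flow ℝ M} {ε δ : ℝ} {k : ℕ}
    {S T : Fin k → Set M} (h : Reaches X S T) (hε : 0 < ε) (hg : 0 < gap X S) :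
    ∃ ρ ε₀, Admissible X ε δ S T ρ ε₀ := by
  obtain ⟨ρ, hρ, hρ'⟩ : ∃ ρ, 0 < ρ ∧ ρ < min (ε / 5) (gap X S / 2) :=
    exists_between (lt_min (by linarith) (by linarith))
  rw [lt_min_iff] at hρ'
  obtain ⟨r, hr, hS⟩ := h ρ hρ
  obtain ⟨d, hd, hu⟩ := uniform_flow X (3 * δ) hr
  obtain ⟨ε₀, hε₀, hε₀'⟩ : ∃ ε₀, 0 < ε₀ ∧ ε₀ < min d (gap X S / 2) :=
    exists_between (lt_min hd (by linarith))
  rw [lt_min_iff] at hε₀'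
  refine ⟨ρ, ε₀, hρ, by linarith, by linarith, hε₀, hε₀'.2, fun i x _ y _ hxy t ht j hj => ?_⟩
  obtain ⟨s, hs, hsS⟩ := hS j _ hj (X t y)
    (hu t t ht.le ht.le (by simpa using hd) y x (by rw [dist_comm]; linarith))
  have := abs_lt.1 hs
  exact mem_flowImage_of_map_mem ⟨by linarith, by linarith⟩ hsS

end CwFlow

theorem mainTheorem2 {M : Type*} [MetricSpace M] [CompactSpace M] (X : Flow ℝ M)
    (hX : ∀ x : M, ∃ t : ℝ, X t x ≠ x) (δ : ℝ) (hδ : 0 < δ) :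
    CwFlow.IsCwExpansive X ↔
      ∀ (ε : ℝ) (k : ℕ) (S T : Fin k → Set M), CwFlow.IsAdequatePair X ε δ S T →
        ∀ ρ ε₀ : ℝ, CwFlow.Admissible X ε δ S T ρ ε₀ →
          ∃ η : ℝ, 0 < η ∧ η < ε₀ ∧
            CwFlow.stableSet X ρ S T η ∩ CwFlow.unstableSet X ρ S T η =
              {A : Set M | ∃ x ∈ ⋃ i, T i, A = {x}} := by
  refine ⟨fun h ε k S T hST ρ ε₀ had => h.exists_eta hST had, fun h => ?_⟩
  rcases isEmpty_or_nonempty M with hM | hM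
  -- Every reparametrization has a guide point, so none exists on an empty space.
  · exact fun ε _ => ⟨1, one_pos, fun A _ _ α _ => (hM.false α.guide.1).elim⟩
  obtain ⟨c, hc, hper⟩ := CwFlow.exists_no_short_period hX
  obtain ⟨ε, k, S, T, hST, hg, hreach⟩ := CwFlow.exists_adequatePair hc hper hδ
  obtain ⟨ρ, ε₀, had⟩ := hreach.exists_admissible (δ := δ) hST.time_pos hg
  obtain ⟨η, hη, -, heq⟩ := h ε k S T hST ρ ε₀ had
  refine CwFlow.isCwExpansive_of_stable_inter_unstable hc hper had.rho_pos (hST.returning hg)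
    hreach had.rho_lt_gap hη fun A hA => ?_
  rw [heq] at hA
  obtain ⟨x, -, rfl⟩ := hA
  exact Set.subsingleton_singleton
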